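/- Let $a,m\in\mathbb R$, $N>0$ and $0<a_1<a_2$. There exists a constant $0<K_2<\infty$ (depending only on $a,m,N,a_1,a_2$) with the following property. Let $\dot W$ be a Gaussian space-time white noise on $[0,\infty)\times\mathbb R$ defined on a probability space $(\Omega,\mathscr F,\mathbb P)$, and let $u$ be the (a.s. continuous version of the) solution of the damped stochastic Klein–Gordon equation $$(\partial_{tt}-\partial_{xx}+a\,\partial_t+m^2)\,u(t,x)=\dot W(t,x),\quad t>0,\ x\in\mathbb R,\qquad u(0,x)=\partial_t u(0,x)=0,$$ that is, $u(t,x)=\int_0^t\int_{\mathbb R}G(t-s,x-y)\,W(ds,dy)$ a.s. for all $t\ge 0$ and $x\in\mathbb R$, where $G$ is the causal fundamental solution of $\partial_{tt}-\partial_{xx}+a\partial_t+m^2$. Then, for every fixed $z_0\in[a_1,a_2]$, $$\mathbb P\left\{\limsup_{h\to0^+}\frac{\left|u\!\left(\frac{w+z_0}{\sqrt2}+h,\frac{-w+z_0}{\sqrt2}+h\right)-u\!\left(\frac{w+z_0}{\sqrt2},\frac{-w+z_0}{\sqrt2}\right)\right|}{\sqrt{h\log\log(1/h)}}\le K_2\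 \text{ for all } w\in[0,N]\right\}=1.$$ -/

import Mathlib

open MeasureTheory ProbabilityTheory Set Filter Topology
open scoped ENNReal

namespace KleinGordon

/-! ### The fundamental solution -/

/-- `G` is a causal (retarded) fundamental solution of `∂_tt - ∂_xx + a ∂_t + m²` on `ℝ × ℝ`
(time, space): it is locally integrable, vanishes for `t ≤ 0`, and solves `L G = δ_{(0,0)}` in the
sense of distributions, the formal adjoint of `L` being `∂_tt - ∂_xx - a ∂_t + m²`. -/
structure IsCausalFundamentalSolution (a m : ℝ) (G : ℝ → ℝ → ℝ) : Prop where
  locallyIntegrable : LocallyIntegrable (fun y : ℝ × ℝ => G y.1 y.2)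
  causal : ∀ t ≤ 0, ∀ x, G t x = 0
  weak_eq : ∀ φ : ℝ × ℝ → ℝ, ContDiff ℝ (⊤ : ℕ∞) φ → HasCompactSupport φ →
    ∫ y : ℝ × ℝ, G y.1 y.2 *
      (iteratedDeriv 2 (fun t => φ (t, y.2)) y.1 - iteratedDeriv 2 (fun x => φ (y.1, x)) y.2
        - a * deriv (fun t => φ (t, y.2)) y.1 + m ^ 2 * φ y) = φ (0, 0)

/-- The entire function `r ↦ ∑ r ^ k / (k!)²`; in terms of Bessel functions,
`kgSeries (s² / 4) = I₀ s` and `kgSeries (-s² / 4) = J₀ s`. -/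
noncomputable def kgSeries (r : ℝ) : ℝ := ∑' k : ℕ, r ^ k / (k.factorial : ℝ) ^ 2

/-- The fundamental solution of `∂_tt - ∂_xx + a ∂_t + m²`, that is
`½ e^{-at/2} J₀(√((m² - a²/4)(t² - x²))) 1_{|x| < t}`, with `J₀(i r) = I₀(r)` if `m² < a²/4`.
That it is a causal fundamental solution is `isCausalFundamentalSolution_kgKernel` below. -/
noncomputable def kgKernel (a m t x : ℝ) : ℝ :=
  if |x| < t then
    Real.exp (-a * t / 2) / 2 * kgSeries ((a ^ 2 / 4 - m ^ 2) * (t ^ 2 - x ^ 2) / 4)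
  else 0

theorem hasDerivAt_tsum_pow (c : ℕ → ℝ) (hc : ∀ k, |c k| ≤ 1 / (k.factorial : ℝ)) (r : ℝ) :
    HasDerivAt (fun r : ℝ => ∑' k : ℕ, c k * r ^ k)
      (∑' k : ℕ, (((k : ℝ) + 1) * c (k + 1)) * r ^ k) r := by
  have hsum : ∀ r : ℝ, Summable (fun k : ℕ => c k * r ^ k) := by
    intro r
    refine Summable.of_norm_bounded (Real.summable_pow_div_factorial |r|) fun k => ?_
    rw [Real.norm_eq_abs, abs_mul, abs_pow, div_eq_inv_mul]
    have := hc k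
    rw [one_div] at this
    gcongr
  have hfun : (fun r : ℝ => ∑' k : ℕ, c k * r ^ k)
      = fun r => c 0 + ∑' k : ℕ, c (k + 1) * r ^ (k + 1) := by
    funext r
    rw [(hsum r).tsum_eq_zero_add]
    simp
  rw [hfun]
  have h := hasDerivAt_tsum_of_isPreconnected (𝕜 := ℝ) (F := ℝ)
    (g := fun (k : ℕ) (y : ℝ) => c (k + 1) * y ^ (k + 1))
    (g' := fun (k : ℕ) (y : ℝ) => (((k : ℝ) + 1) * c (k + 1)) * y ^ k)
    (u := fun k : ℕ => (|r| + 1) ^ k / (k.factorial : ℝ)) (t := Metric.ball 0 (|r| + 1))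
    (y₀ := r) (y := r)
    (Real.summable_pow_div_factorial _) Metric.isOpen_ball
    (convex_ball _ _).isPreconnected ?_ ?_ (by simp) ?_ (by simp)
  · exact h.const_add (c 0)
  · intro k y _
    have := (hasDerivAt_pow (k + 1) y).const_mul (c (k + 1))
    refine this.congr_deriv ?_
    rw [Nat.add_sub_cancel]
    push_cast
    ring
  · intro k y hy
    have hy' : |y| ≤ |r| + 1 := by
      have h0 := mem_ball_zero_iff.1 hy
      rw [Real.norm_eq_abs] at h0
      exact h0.le
    rw [Real.norm_eq_abs, abs_mul, abs_mul, abs_pow, div_eq_inv_mul]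
    have h1 : |(k : ℝ) + 1| * |c (k + 1)| ≤ (k.factorial : ℝ)⁻¹ := by
      have h2 := hc (k + 1)
      rw [abs_of_nonneg (by positivity : (0 : ℝ) ≤ (k : ℝ) + 1)]
      calc ((k : ℝ) + 1) * |c (k + 1)| ≤ ((k : ℝ) + 1) * (1 / ((k + 1).factorial : ℝ)) := by gcongr
        _ = (k.factorial : ℝ)⁻¹ := by
          rw [Nat.factorial_succ]; push_cast; field_simp
    gcongr
  · exact (summable_nat_add_iff (f := fun k : ℕ => c k * r ^ k) 1).2 (hsum r)

/-- The derivative of `kgSeries`. -/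
noncomputable def kgSeriesAux (r : ℝ) : ℝ :=
  ∑' k : ℕ, 1 / ((k.factorial : ℝ) * ((k + 1).factorial : ℝ)) * r ^ k

theorem one_le_factorial_cast (k : ℕ) : (1 : ℝ) ≤ k.factorial := by
  exact_mod_cast Nat.one_le_iff_ne_zero.2 (Nat.factorial_ne_zero k)

theorem kgSeries_hasDerivAt (r : ℝ) : HasDerivAt kgSeries (kgSeriesAux r) r := by
  have h := hasDerivAt_tsum_pow (fun k => 1 / (k.factorial : ℝ) ^ 2) (fun k => by
    have := one_le_factorial_cast k
    rw [abs_of_nonneg (by positivity)]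
    gcongr
    nlinarith) r
  have e1 : kgSeries = fun r : ℝ => ∑' k : ℕ, 1 / (k.factorial : ℝ) ^ 2 * r ^ k := by
    funext r; unfold kgSeries; congr 1; funext k; ring
  rw [e1]
  convert h using 1
  unfold kgSeriesAux
  congr 1; funext k
  rw [Nat.factorial_succ]; push_cast
  field_simp

theorem kgSeriesAux_differentiable : Differentiable ℝ kgSeriesAux := by
  intro r
  refine (hasDerivAt_tsum_pow _ (fun k => ?_) r).differentiableAt
  have := one_le_factorial_cast k
  have := one_le_factorial_cast (k + 1)
  rw [abs_of_nonneg (by positivity)]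
  gcongr
  nlinarith

theorem kgSeriesAux_hasDerivAt (r : ℝ) :
    HasDerivAt (fun r => r * kgSeriesAux r) (kgSeries r) r := by
  have h := hasDerivAt_tsum_pow
    (fun k => (k : ℝ) * (1 / (k.factorial : ℝ) ^ 2)) (fun k => by
    have := one_le_factorial_cast k
    have h3 : (k : ℝ) ≤ k.factorial := by exact_mod_cast Nat.self_le_factorial k
    rw [abs_of_nonneg (by positivity), mul_one_div, div_le_div_iff₀ (by positivity) (by positivity)]
    nlinarith) r
  have e1 : (fun r : ℝ => r * kgSeriesAux r)
      = fun r : ℝ => ∑' k : ℕ, (k : ℝ) * (1 / (k.factorial : ℝ) ^ 2) * r ^ k := by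
    funext r
    rw [tsum_eq_zero_add' ]
    · simp only [Nat.cast_zero, zero_mul, zero_add]
      unfold kgSeriesAux
      rw [← tsum_mul_left]
      congr 1; funext k
      rw [Nat.factorial_succ]; push_cast
      field_simp
      ring
    · refine Summable.of_norm_bounded (g := fun k : ℕ => |r| * (|r| ^ k / (k.factorial : ℝ)))
        ((Real.summable_pow_div_factorial |r|).mul_left _) fun k => ?_
      have := one_le_factorial_cast k
      rw [Real.norm_eq_abs, abs_mul, abs_pow, abs_of_nonneg (by positivity)]
      have : ((k + 1 : ℕ) : ℝ) * (1 / ((k + 1).factorial : ℝ) ^ 2) ≤ 1 / (k.factorial : ℝ) := by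
        rw [Nat.factorial_succ]; push_cast
        rw [mul_one_div, div_le_div_iff₀ (by positivity) (by positivity)]
        have : (0:ℝ) ≤ (k:ℝ) := by positivity
        have h4 : (1:ℝ) ≤ (k + 1) * k.factorial := by nlinarith
        nlinarith [mul_nonneg (by positivity : (0:ℝ) ≤ ((k:ℝ) + 1) * k.factorial) (sub_nonneg.2 h4)]
      calc _ ≤ 1 / (k.factorial : ℝ) * |r| ^ (k + 1) := by gcongr
        _ = _ := by ring
  rw [e1]
  convert h using 1
  unfold kgSeries
  congr 1; funext k
  rw [Nat.factorial_succ]; push_cast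
  field_simp

theorem kgSeries_continuous : Continuous kgSeries :=
  continuous_iff_continuousAt.2 fun r => (kgSeries_hasDerivAt r).continuousAt

theorem kgSeriesAux_continuous : Continuous kgSeriesAux := kgSeriesAux_differentiable.continuous

theorem kgSeries_zero : kgSeries 0 = 1 := by
  unfold kgSeries
  rw [tsum_eq_single 0]
  · simp
  · intro k hk; simp [hk]

theorem tendsto_slice {f : ℝ × ℝ → ℝ} (hf : HasCompactSupport f) (L : ℝ → ℝ × ℝ)
    (hL : IsClosedEmbedding L) : Tendsto (fun s => f (L s)) atTop (𝓝 0) := by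
  have h := hf.comp_isClosedEmbedding hL
  have := h.is_zero_at_infty
  exact this.mono_left atTop_le_cocompact

theorem closedEmb_left (q : ℝ) : IsClosedEmbedding (fun p : ℝ => (p, q)) := by
  refine Topology.IsClosedEmbedding.of_continuous_injective_isClosedMap (by fun_prop) (fun a b h => by simpa using h) ?_
  exact isClosedMap_prodMk_right q

theorem closedEmb_right (p : ℝ) : IsClosedEmbedding (fun q : ℝ => (p, q)) := by
  refine Topology.IsClosedEmbedding.of_continuous_injective_isClosedMap (by fun_prop) (fun a b h => by simpa using h) ?_
  exact isClosedMap_prodMk_left p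

theorem goursat (c : ℝ) (f g k : ℝ × ℝ → ℝ) (hf : Continuous f) (hg : Continuous g)
    (hk : Continuous k) (hfs : HasCompactSupport f) (hgs : HasCompactSupport g)
    (hks : HasCompactSupport k)
    (h1 : ∀ p q, HasDerivAt (fun q => f (p, q)) (g (p, q)) q)
    (h2 : ∀ p q, HasDerivAt (fun p => g (p, q)) (k (p, q)) p) :
    ∫ y in (Ioi (0 : ℝ)) ×ˢ (Ioi (0 : ℝ)),
      kgSeries (c * (y.1 * y.2)) * (k y - c * f y) = f (0, 0) := by
  have hF := kgSeries_continuous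
  have hF1 := kgSeriesAux_continuous
  set A : ℝ × ℝ → ℝ := fun y => kgSeriesAux (c * (y.1 * y.2)) * (c * y.2) * g y
    + kgSeries (c * (y.1 * y.2)) * k y with hA
  set B : ℝ × ℝ → ℝ := fun y => c * kgSeries (c * (y.1 * y.2)) * f y
    + (c * y.2 * kgSeriesAux (c * (y.1 * y.2))) * g y with hB
  have hAc : Continuous A := by fun_prop
  have hBc : Continuous B := by fun_prop
  have hAs : HasCompactSupport A := (hgs.mul_left).add (hks.mul_left)
  have hBs : HasCompactSupport B := (hfs.mul_left).add (hgs.mul_left)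
  have hAi : Integrable A := hAc.integrable_of_hasCompactSupport hAs
  have hBi : Integrable B := hBc.integrable_of_hasCompactSupport hBs
  have hsl1 : ∀ (u : ℝ × ℝ → ℝ), Continuous u → HasCompactSupport u → ∀ q,
      Integrable (fun p => u (p, q)) := fun u hu hus q =>
    (hu.comp (by fun_prop : Continuous fun p : ℝ => (p, q))).integrable_of_hasCompactSupport
      (hus.comp_isClosedEmbedding (closedEmb_left q))
  have hsl2 : ∀ (u : ℝ × ℝ → ℝ), Continuous u → HasCompactSupport u → ∀ p,
      Integrable (fun q => u (p, q)) := fun u hu hus p =>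
    (hu.comp (by fun_prop : Continuous fun q : ℝ => (p, q))).integrable_of_hasCompactSupport
      (hus.comp_isClosedEmbedding (closedEmb_right p))
  have e0 : ∀ y : ℝ × ℝ, kgSeries (c * (y.1 * y.2)) * (k y - c * f y) = A y - B y := by
    intro y; simp only [hA, hB]; ring
  simp_rw [e0]
  rw [integral_sub hAi.integrableOn hBi.integrableOn]
  have IB : ∫ y in (Ioi (0 : ℝ)) ×ˢ (Ioi (0 : ℝ)), B y = 0 := by
    rw [Measure.volume_eq_prod, setIntegral_prod _ (by rw [← Measure.volume_eq_prod]; exact hBi.integrableOn)]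
    refine setIntegral_eq_zero_of_forall_eq_zero fun p hp => ?_
    have hp : p ≠ 0 := ne_of_gt hp
    rw [integral_Ioi_of_hasDerivAt_of_tendsto'
      (f := fun q => c * q * kgSeriesAux (c * (p * q)) * f (p, q)) (m := 0) ?_
      (hsl2 B hBc hBs p).integrableOn ?_]
    · simp
    · intro q _
      have d1 : HasDerivAt (fun q => c * q * kgSeriesAux (c * (p * q)))
          (c * kgSeries (c * (p * q))) q := by
        have e := ((kgSeriesAux_hasDerivAt (c * (p * q))).comp q
          (((hasDerivAt_id q).const_mul p).const_mul c)).const_mul (1 / p)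
        refine (e.congr_deriv (by field_simp)).congr_of_eventuallyEq (Eventually.of_forall fun q => ?_)
        simp only [Function.comp, id]
        field_simp
      exact d1.mul (h1 p q)
    · have := tendsto_slice (f := fun y => (c * y.2 * kgSeriesAux (c * (y.1 * y.2))) * f y)
        hfs.mul_left _ (closedEmb_right p)
      exact this
  have IA : ∫ y in (Ioi (0 : ℝ)) ×ˢ (Ioi (0 : ℝ)), A y = f (0, 0) := by
    rw [Measure.volume_eq_prod, setIntegral_prod _ (by rw [← Measure.volume_eq_prod]; exact hAi.integrableOn),
      integral_integral_swap]
    swap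
    · rw [Measure.prod_restrict, ← Measure.volume_eq_prod]; exact hAi.integrableOn
    have inner : ∀ q : ℝ, ∫ p in Ioi (0 : ℝ), A (p, q) = - g (0, q) := by
      intro q
      rw [integral_Ioi_of_hasDerivAt_of_tendsto'
        (f := fun p => kgSeries (c * (p * q)) * g (p, q)) (m := 0) ?_
        (hsl1 A hAc hAs q).integrableOn ?_]
      · simp [kgSeries_zero]
      · intro p _
        have e := ((kgSeries_hasDerivAt (c * (p * q))).comp p
          (((hasDerivAt_id p).mul_const q).const_mul c)).mul (h2 p q)
        refine e.congr_deriv ?_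
        simp only [hA, Function.comp, id]
        ring
      · have := tendsto_slice (f := fun y => kgSeries (c * (y.1 * y.2)) * g y)
          hgs.mul_left _ (closedEmb_left q)
        exact this
    simp_rw [inner]
    rw [integral_neg, integral_Ioi_of_hasDerivAt_of_tendsto'
      (f := fun q => f (0, q)) (m := 0) (fun q _ => h1 0 q) (hsl2 g hg hgs 0).integrableOn
      (tendsto_slice hfs _ (closedEmb_right 0))]
    simp
  rw [IA, IB, sub_zero]

/-- The map from light-cone coordinates `(t + x, t - x)` to `(t, x)`. -/
noncomputable def lc : ℝ × ℝ →L[ℝ] ℝ × ℝ :=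
  LinearMap.toContinuousLinearMap (Matrix.toLin (Module.Basis.finTwoProd ℝ)
    (Module.Basis.finTwoProd ℝ) !![1 / 2, 1 / 2; 1 / 2, -(1 / 2)])

theorem lc_apply (y : ℝ × ℝ) : lc y = ((y.1 + y.2) / 2, (y.1 - y.2) / 2) := by
  rw [lc, LinearMap.coe_toContinuousLinearMap', Matrix.toLin_finTwoProd_apply]
  ext <;> simp <;> ring

theorem lc_det : |lc.det| = 1 / 2 := by
  rw [lc, LinearMap.det_toContinuousLinearMap, LinearMap.det_toLin, Matrix.det_fin_two_of]
  norm_num [abs_of_neg]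

theorem lc_image : lc '' ((Ioi (0 : ℝ)) ×ˢ (Ioi (0 : ℝ))) = {y : ℝ × ℝ | |y.2| < y.1} := by
  ext ⟨t, x⟩
  simp only [mem_image, mem_prod, mem_Ioi, lc_apply, mem_ofPred_eq, abs_lt, Prod.exists, Prod.mk.injEq]
  constructor
  · rintro ⟨p, q, ⟨hp, hq⟩, rfl, rfl⟩
    constructor <;> linarith
  · rintro ⟨h1, h2⟩
    exact ⟨t + x, t - x, ⟨by linarith, by linarith⟩, by ring, by ring⟩

theorem lc_injective : Function.Injective lc := by
  rintro ⟨p, q⟩ ⟨p', q'⟩ h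
  simp only [lc_apply, Prod.mk.injEq] at h ⊢
  constructor <;> linarith [h.1, h.2]

theorem lc_closedEmb : IsClosedEmbedding lc :=
  LinearMap.isClosedEmbedding_of_injective (f := lc.toLinearMap) (LinearMap.ker_eq_bot.2 lc_injective)

theorem hasDerivAt_fst {ψ : ℝ × ℝ → ℝ} (h : Differentiable ℝ ψ) (t x : ℝ) :
    HasDerivAt (fun t => ψ (t, x)) (fderiv ℝ ψ (t, x) (1, 0)) t := by
  exact ((h (t, x)).hasFDerivAt.comp_hasDerivAt t ((hasDerivAt_id t).prodMk (hasDerivAt_const t x)))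

theorem hasDerivAt_snd {ψ : ℝ × ℝ → ℝ} (h : Differentiable ℝ ψ) (t x : ℝ) :
    HasDerivAt (fun x => ψ (t, x)) (fderiv ℝ ψ (t, x) (0, 1)) x := by
  exact ((h (t, x)).hasFDerivAt.comp_hasDerivAt x ((hasDerivAt_const x t).prodMk (hasDerivAt_id x)))

theorem hasDerivAt_lc_fst {ψ : ℝ × ℝ → ℝ} (h : Differentiable ℝ ψ) (p q : ℝ) :
    HasDerivAt (fun p => ψ (lc (p, q)))
      ((fderiv ℝ ψ (lc (p, q)) (1, 0) + fderiv ℝ ψ (lc (p, q)) (0, 1)) / 2) p := by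
  have := ((h (lc (p, q))).hasFDerivAt.comp_hasDerivAt p (lc.hasFDerivAt.comp_hasDerivAt p
    ((hasDerivAt_id p).prodMk (hasDerivAt_const p q))))
  refine this.congr_deriv ?_
  have e : lc ((1 : ℝ), (0 : ℝ)) = (1 / 2 : ℝ) • ((1, 0) + (0, 1)) := by
    rw [lc_apply]; ext <;> simp
  rw [e, map_smul, map_add]; simp; ring

theorem hasDerivAt_lc_snd {ψ : ℝ × ℝ → ℝ} (h : Differentiable ℝ ψ) (p q : ℝ) :
    HasDerivAt (fun q => ψ (lc (p, q)))
      ((fderiv ℝ ψ (lc (p, q)) (1, 0) - fderiv ℝ ψ (lc (p, q)) (0, 1)) / 2) q := by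
  have := ((h (lc (p, q))).hasFDerivAt.comp_hasDerivAt q (lc.hasFDerivAt.comp_hasDerivAt q
    ((hasDerivAt_const q p).prodMk (hasDerivAt_id q))))
  refine this.congr_deriv ?_
  have e : lc ((0 : ℝ), (1 : ℝ)) = (1 / 2 : ℝ) • ((1, 0) - (0, 1)) := by
    rw [lc_apply]; ext <;> simp; norm_num
  rw [e, map_smul, map_sub]; simp; ring

theorem kgKernel_weak_eq (a m : ℝ) (φ : ℝ × ℝ → ℝ) (hφ : ContDiff ℝ (⊤ : ℕ∞) φ)
    (hs : HasCompactSupport φ) :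
    ∫ y : ℝ × ℝ, kgKernel a m y.1 y.2 *
      (iteratedDeriv 2 (fun t => φ (t, y.2)) y.1 - iteratedDeriv 2 (fun x => φ (y.1, x)) y.2
        - a * deriv (fun t => φ (t, y.2)) y.1 + m ^ 2 * φ y) = φ (0, 0) := by
  have smooth_fd : ∀ {ψ : ℝ × ℝ → ℝ}, ContDiff ℝ (⊤ : ℕ∞) ψ → ∀ v, ContDiff ℝ (⊤ : ℕ∞) (fun y => fderiv ℝ ψ y v) :=
    fun h v => (h.fderiv_right (by simp)).clm_apply contDiff_const
  have diff_of : ∀ {ψ : ℝ × ℝ → ℝ}, ContDiff ℝ (⊤ : ℕ∞) ψ → Differentiable ℝ ψ :=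
    fun h => h.differentiable (by simp)
  set T : ℝ × ℝ → ℝ := fun y => fderiv ℝ φ y (1, 0) with hT
  set X : ℝ × ℝ → ℝ := fun y => fderiv ℝ φ y (0, 1) with hX
  have cT : ContDiff ℝ (⊤ : ℕ∞) T := smooth_fd hφ _
  have cX : ContDiff ℝ (⊤ : ℕ∞) X := smooth_fd hφ _
  set TT : ℝ × ℝ → ℝ := fun y => fderiv ℝ T y (1, 0) with hTT
  set XX : ℝ × ℝ → ℝ := fun y => fderiv ℝ X y (0, 1) with hXX
  have cTT : ContDiff ℝ (⊤ : ℕ∞) TT := smooth_fd cT _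
  have cXX : ContDiff ℝ (⊤ : ℕ∞) XX := smooth_fd cX _
  have sT : HasCompactSupport T := hs.fderiv_apply ℝ _
  have sX : HasCompactSupport X := hs.fderiv_apply ℝ _
  have sTT : HasCompactSupport TT := sT.fderiv_apply ℝ _
  have sXX : HasCompactSupport XX := sX.fderiv_apply ℝ _
  have symm : ∀ y, fderiv ℝ T y (0, 1) = fderiv ℝ X y (1, 0) := by
    intro y
    have hd : HasFDerivAt (fderiv ℝ φ) (fderiv ℝ (fderiv ℝ φ) y) y :=
      (((hφ.fderiv_right (m := ((⊤ : ℕ∞) : WithTop ℕ∞)) (by simp)).differentiable (by simp)) y).hasFDerivAt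
    have h := second_derivative_symmetric (f := φ) (f' := fderiv ℝ φ)
      (fun y => (diff_of hφ y).hasFDerivAt) hd (0, 1) (1, 0)
    have e1 : fderiv ℝ T y (0, 1) = fderiv ℝ (fderiv ℝ φ) y (0, 1) (1, 0) := by
      rw [hT, (hd.clm_apply (hasFDerivAt_const ((1 : ℝ), (0 : ℝ)) y)).fderiv]; simp
    have e2 : fderiv ℝ X y (1, 0) = fderiv ℝ (fderiv ℝ φ) y (1, 0) (0, 1) := by
      rw [hX, (hd.clm_apply (hasFDerivAt_const ((0 : ℝ), (1 : ℝ)) y)).fderiv]; simp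
    rw [e1, e2, h]
  have d1 : ∀ t x, deriv (fun t => φ (t, x)) t = T (t, x) := fun t x =>
    (hasDerivAt_fst (diff_of hφ) t x).deriv
  have d2 : ∀ t x, iteratedDeriv 2 (fun t => φ (t, x)) t = TT (t, x) := by
    intro t x
    rw [iteratedDeriv_succ, iteratedDeriv_one]
    simp_rw [funext fun t => d1 t x]
    exact (hasDerivAt_fst (diff_of cT) t x).deriv
  have d3 : ∀ t x, iteratedDeriv 2 (fun x => φ (t, x)) x = XX (t, x) := by
    intro t x
    rw [iteratedDeriv_succ, iteratedDeriv_one]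
    simp_rw [funext fun x => (hasDerivAt_snd (diff_of hφ) t x).deriv]
    exact (hasDerivAt_snd (diff_of cX) t x).deriv
  simp_rw [d1, d2, d3]
  set S : Set (ℝ × ℝ) := {y : ℝ × ℝ | |y.2| < y.1} with hS
  have hSm : MeasurableSet S := measurableSet_lt (by fun_prop) (by fun_prop)
  have step1 : (∫ y : ℝ × ℝ, kgKernel a m y.1 y.2 * (TT (y.1, y.2) - XX (y.1, y.2)
      - a * T (y.1, y.2) + m ^ 2 * φ y))
      = ∫ y in S, (Real.exp (-a * y.1 / 2) / 2
        * kgSeries ((a ^ 2 / 4 - m ^ 2) * (y.1 ^ 2 - y.2 ^ 2) / 4))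
          * (TT y - XX y - a * T y + m ^ 2 * φ y) := by
    rw [← integral_indicator hSm]
    congr 1; funext y
    by_cases hy : |y.2| < y.1
    · rw [indicator_of_mem (show y ∈ S from hy), kgKernel, if_pos hy]
    · rw [indicator_of_notMem (show y ∉ S from hy), kgKernel, if_neg hy, zero_mul]
  rw [step1, hS, ← lc_image, integral_image_eq_integral_abs_det_fderiv_smul volume
    (measurableSet_Ioi.prod measurableSet_Ioi) (fun x _ => lc.hasFDerivAt.hasFDerivWithinAt)
    lc_injective.injOn]
  set E : ℝ × ℝ → ℝ := fun y => Real.exp (-a / 4 * (y.1 + y.2)) with hE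
  have cE : Continuous E := by fun_prop
  have dE1 : ∀ p q, HasDerivAt (fun p => E (p, q)) (-a / 4 * E (p, q)) p := by
    intro p q
    have h := (((hasDerivAt_id' p).add_const q).const_mul (-a / 4)).exp
    exact h.congr_deriv (by simp only [hE]; ring)
  have dE2 : ∀ p q, HasDerivAt (fun q => E (p, q)) (-a / 4 * E (p, q)) q := by
    intro p q
    have h := (((hasDerivAt_id' q).const_add p).const_mul (-a / 4)).exp
    exact h.congr_deriv (by simp only [hE]; ring)
  have cc : ∀ {ψ : ℝ × ℝ → ℝ}, ContDiff ℝ (⊤ : ℕ∞) ψ → Continuous (fun y => ψ (lc y)) := fun h =>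
    h.continuous.comp lc.continuous
  have ss : ∀ {ψ : ℝ × ℝ → ℝ}, HasCompactSupport ψ → HasCompactSupport (fun y => ψ (lc y)) :=
    fun h => h.comp_isClosedEmbedding lc_closedEmb
  have c0 := cc hφ
  have c1 := cc cT
  have c2 := cc cX
  have c3 := cc cTT
  have c4 := cc cXX
  have s1 : HasCompactSupport (fun y => T (lc y) + -1 * X (lc y)) := by
    have h := (ss sX).mul_left (f := fun _ => (-1 : ℝ))
    exact (ss sT).add h
  have s2 : HasCompactSupport (fun y => TT (lc y) + -1 * XX (lc y)) := by
    have h := (ss sXX).mul_left (f := fun _ => (-1 : ℝ))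
    exact (ss sTT).add h
  have s0 := (ss hs).mul_left (f := fun _ => -a / 4)
  have s0' := (ss hs).mul_left (f := fun _ => a ^ 2 / 16)
  have s1' := s1.mul_left (f := fun _ => (1 / 2 : ℝ))
  have s2' := s2.mul_left (f := fun _ => (1 / 4 : ℝ))
  have sT' := (ss sT).mul_left (f := fun _ => -a / 4)
  have s3 : HasCompactSupport
      (fun y => -a / 4 * φ (lc y) + 1 / 2 * (T (lc y) + -1 * X (lc y))) := s0.add s1'
  have s4 : HasCompactSupport (fun y => a ^ 2 / 16 * φ (lc y)
      + (-a / 4 * T (lc y) + 1 / 4 * (TT (lc y) + -1 * XX (lc y)))) := s0'.add (sT'.add s2')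
  have vT : ∀ y, fderiv ℝ φ y (1, 0) = T y := fun y => rfl
  have vX : ∀ y, fderiv ℝ φ y (0, 1) = X y := fun y => rfl
  have vTT : ∀ y, fderiv ℝ T y (1, 0) = TT y := fun y => rfl
  have vXX : ∀ y, fderiv ℝ X y (0, 1) = XX y := fun y => rfl
  have vE : ∀ y, E y = Real.exp (-a / 4 * (y.1 + y.2)) := fun y => rfl
  clear_value T X TT XX E
  have D1 : ∀ p q, HasDerivAt (fun q => E (p, q) * φ (lc (p, q)))
      (E (p, q) * (-a / 4 * φ (lc (p, q)) + 1 / 2 * (T (lc (p, q)) + -1 * X (lc (p, q))))) q := by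
    intro p q
    have A1 := hasDerivAt_lc_snd (diff_of hφ) p q
    rw [vT, vX] at A1
    have A2 := (dE2 p q).fun_mul A1
    exact A2.congr_deriv (by ring)
  have D2 : ∀ p q, HasDerivAt (fun p => E (p, q) *
      (-a / 4 * φ (lc (p, q)) + 1 / 2 * (T (lc (p, q)) + -1 * X (lc (p, q)))))
      (E (p, q) * (a ^ 2 / 16 * φ (lc (p, q)) + (-a / 4 * T (lc (p, q))
        + 1 / 4 * (TT (lc (p, q)) + -1 * XX (lc (p, q)))))) p := by
    intro p q
    have A1 := hasDerivAt_lc_fst (diff_of hφ) p q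
    have A2 := hasDerivAt_lc_fst (diff_of cT) p q
    have A3 := hasDerivAt_lc_fst (diff_of cX) p q
    rw [vT, vX] at A1
    rw [vTT, symm] at A2
    rw [vXX] at A3
    have A4 := (dE1 p q).fun_mul ((A1.const_mul (-a / 4)).fun_add
      ((A2.fun_add (A3.const_mul (-1))).const_mul (1 / 2)))
    exact A4.congr_deriv (by ring)
  have C2 : Continuous (fun y => E y * φ (lc y)) := cE.mul c0
  have S2 := (ss hs).mul_left (f := E)
  have S3 := s3.mul_left (f := E)
  have S4 := s4.mul_left (f := E)
  have C3 : Continuous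
      (fun y => E y * (-a / 4 * φ (lc y) + 1 / 2 * (T (lc y) + -1 * X (lc y)))) := by fun_prop
  have C4 : Continuous (fun y => E y * (a ^ 2 / 16 * φ (lc y)
      + (-a / 4 * T (lc y) + 1 / 4 * (TT (lc y) + -1 * XX (lc y))))) := by fun_prop
  have key := goursat ((a ^ 2 / 4 - m ^ 2) / 4) _ _ _ C2 C3 C4 S2 S3 S4 D1 D2
  have e00 : E ((0 : ℝ), (0 : ℝ)) * φ (lc ((0 : ℝ), (0 : ℝ))) = φ (0, 0) := by
    simp [vE, lc_apply]
  rw [← e00, ← key]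
  congr 1; funext y
  rw [lc_det, smul_eq_mul]
  have f1 : -a * (lc y).1 / 2 = -a / 4 * (y.1 + y.2) := by rw [lc_apply]; ring
  have f2 : (a ^ 2 / 4 - m ^ 2) * ((lc y).1 ^ 2 - (lc y).2 ^ 2) / 4
      = (a ^ 2 / 4 - m ^ 2) / 4 * (y.1 * y.2) := by rw [lc_apply]; ring
  rw [f1, f2]
  simp only [vE]
  ring

theorem kgKernel_locallyIntegrable (a m : ℝ) :
    LocallyIntegrable (fun y : ℝ × ℝ => kgKernel a m y.1 y.2) := by
  have hF := kgSeries_continuous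
  have hSm : MeasurableSet {y : ℝ × ℝ | |y.2| < y.1} :=
    measurableSet_lt (by fun_prop) (by fun_prop)
  have hc : Continuous (fun y : ℝ × ℝ => Real.exp (-a * y.1 / 2) / 2
      * kgSeries ((a ^ 2 / 4 - m ^ 2) * (y.1 ^ 2 - y.2 ^ 2) / 4)) := by fun_prop
  exact (hc.locallyIntegrable (μ := volume)).indicator hSm

theorem isCausalFundamentalSolution_kgKernel (a m : ℝ) :
    IsCausalFundamentalSolution a m (kgKernel a m) where
  locallyIntegrable := kgKernel_locallyIntegrable a m
  causal := fun t ht x => if_neg (fun h => absurd (abs_nonneg x) (by linarith))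
  weak_eq := kgKernel_weak_eq a m

/-! ### Space-time white noise and the Wiener integral -/

/-- Lebesgue measure on `[0, ∞) × ℝ` (time, space), as a measure on `ℝ × ℝ`. -/
noncomputable def spaceTime : Measure (ℝ × ℝ) := volume.restrict (Ici (0 : ℝ) ×ˢ univ)

/-- `W` is a Gaussian white noise based on `μ`: a centered Gaussian process indexed by the
measurable sets of finite `μ`-measure, with `E[W(A) W(B)] = μ(A ∩ B)`. (The values of `W` on other
sets are irrelevant.) -/
structure IsWhiteNoise {E Ω : Type*} [MeasurableSpace E] [MeasurableSpace Ω]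
    (μ : Measure E) (P : Measure Ω) (W : Set E → Ω → ℝ) : Prop where
  isGaussianProcess :
    IsGaussianProcess (fun A : {A : Set E // MeasurableSet A ∧ μ A ≠ ∞} => W A) P
  mean_zero : ∀ A, MeasurableSet A → μ A ≠ ∞ → ∫ ω, W A ω ∂P = 0
  covariance : ∀ A B, MeasurableSet A → μ A ≠ ∞ → MeasurableSet B → μ B ≠ ∞ →
    ∫ ω, W A ω * W B ω ∂P = (μ (A ∩ B)).toReal

/-- The integral `∑ c W(φ = c)` of a simple function against `W`. -/
noncomputable def simpleIntegral {E Ω : Type*} [MeasurableSpace E]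
    (W : Set E → Ω → ℝ) (φ : SimpleFunc E ℝ) (ω : Ω) : ℝ :=
  ∑ c ∈ φ.range, c * W (φ ⁻¹' {c}) ω

/-- `X = ∫ f dW` for a deterministic integrand `f`: `X` is the limit in `L²(P)` of the integrals
of square-integrable simple functions that converge to `f` in `L²(μ)`. -/
def IsWienerIntegral {E Ω : Type*} [MeasurableSpace E] [MeasurableSpace Ω]
    (μ : Measure E) (P : Measure Ω) (W : Set E → Ω → ℝ) (f : E → ℝ) (X : Ω → ℝ) : Prop :=
  MemLp X 2 P ∧ ∃ φ : ℕ → SimpleFunc E ℝ,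
    (∀ n, MemLp (φ n) 2 μ) ∧
    Tendsto (fun n => eLpNorm (fun y => φ n y - f y) 2 μ) atTop (𝓝 0) ∧
    Tendsto (fun n => eLpNorm (fun ω => simpleIntegral W (φ n) ω - X ω) 2 P) atTop (𝓝 0)

/-- `u` is the solution of `(∂_tt - ∂_xx + a ∂_t + m²) u = Ẇ`, `u(0, ·) = ∂_t u(0, ·) = 0`:
`u(t, x) = ∫_0^t ∫_ℝ G(t - s, x - y) W(ds, dy)` a.s. for all `t ≥ 0` and `x`, where `W` lives on
`[0, ∞) × ℝ` and `G(t - s, ·) = 0` for `s ≥ t`. -/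
def IsMildSolution {Ω : Type*} [MeasurableSpace Ω] (a m : ℝ) (P : Measure Ω)
    (W : Set (ℝ × ℝ) → Ω → ℝ) (u : ℝ → ℝ → Ω → ℝ) : Prop :=
  ∀ t : ℝ, 0 ≤ t → ∀ x : ℝ,
    IsWienerIntegral spaceTime P W (fun y => kgKernel a m (t - y.1) (x - y.2)) (u t x)

end KleinGordon

namespace KleinGordon

/-! In the light-cone coordinates p = t + x, q = t - x, the increment in question moves p from p₀ =
√2 z₀ to p₀ + 2h and leaves q = √2 w fixed. The claim is the upper half of a law of the iterated
logarithm at the single point p₀, uniform in q. Uniformity in w costs only a constant, because the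
supremum over q is put inside each event before Borel–Cantelli is applied.

The kernel of u is a C¹ function cut off to a quadrant ξ < p, η < q. Moving p by Δp changes it by
O(Δp) inside the quadrant and by O(1) on a strip of width Δp, so its increment has squared L² norm
O(Δp); a rectangular increment has O(Δp Δq) (`exists_eLpNorm_coneKernel_le`). Write û for u in these
coordinates and X(s, v) = û(p₀ + ηs, Qv) - û(p₀, Qv) on the unit square. Then the increments of X
have variance O(ηd) when s and v move by at most d (`exists_measure_lt_abs_coneIncrement_sub_le`);
the rectangular bound supplies the factor η when v moves.

Gaussian tails (`IsWhiteNoise.measure_lt_abs_wienerIntegral_le`) and dyadic chaining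
(`exists_measure_le_chaining`) bound sup |X| by a constant times √(ηL) outside an event of
probability at most 16 exp(-L). With η = 4 · 2⁻ⁿ and L = 2 log n these probabilities are summable,
so almost surely the bound holds for all large n. For h of order 2⁻ⁿ, η log n is at most a constant
times h log log(1/h). Since the supremum runs over all s, no interpolation between scales is needed.
-/

/-! ### Gaussian tails and their passage to the limit. -/

theorem measure_lt_abs_le_of_map_eq_gaussianReal {Ω : Type*} [MeasurableSpace Ω] {P : Measure Ω}
    [IsProbabilityMeasure P] {Z : Ω → ℝ} {v : NNReal} (hZ : P.map Z = gaussianReal 0 v) {s r : ℝ}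
    (hs : 0 < s) (hv : (v : ℝ) ≤ s) (hr : 0 ≤ r) :
    P {ω | r < |Z ω|} ≤ ENNReal.ofReal (2 * Real.exp (-r ^ 2 / (2 * s))) := by
  -- The push-forward under a map that is not a.e. measurable is zero, so a nonzero law already
  -- gives measurability.
  have hm : AEMeasurable Z P := aemeasurable_of_map_neZero (by rw [hZ]; infer_instance)
  have key : ∀ {Y : Ω → ℝ}, P.map Y = gaussianReal 0 v →
      P.real {ω | r ≤ Y ω} ≤ Real.exp (-r ^ 2 / (2 * s)) := by
    intro Y hY
    have hsub : HasSubgaussianMGF Y s.toNNReal P := by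
      refine ⟨fun t => ?_, fun t => ?_⟩
      · have h1 : AEMeasurable Y P := aemeasurable_of_map_neZero (by rw [hY]; infer_instance)
        have h2 := integrable_exp_mul_gaussianReal (μ := 0) (v := v) t
        rw [← hY] at h2
        exact h2.comp_aemeasurable h1
      · rw [mgf_gaussianReal hY, Real.exp_le_exp, Real.coe_toNNReal s hs.le]
        nlinarith [sq_nonneg t]
    have := hsub.measure_ge_le hr
    rwa [Real.coe_toNNReal s hs.le] at this
  have k1 := key hZ
  have k2 := key (Y := fun ω => - Z ω) (by
    have := gaussianReal_map_neg (μ := 0) (v := v)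
    rw [← hZ, AEMeasurable.map_map_of_aemeasurable (by fun_prop) hm, neg_zero] at this
    exact this)
  have hsub : {ω | r < |Z ω|} ⊆ {ω | r ≤ Z ω} ∪ {ω | r ≤ -Z ω} := by
    intro ω hω
    have hω : r < |Z ω| := hω
    rcases lt_abs.1 hω with h | h
    · exact Or.inl h.le
    · exact Or.inr h.le
  rw [← ENNReal.ofReal_toReal (measure_ne_top P {ω | r < |Z ω|})]
  refine ENNReal.ofReal_le_ofReal ?_
  calc P.real {ω | r < |Z ω|} ≤ P.real ({ω | r ≤ Z ω} ∪ {ω | r ≤ -Z ω}) := measureReal_mono hsub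
    _ ≤ _ := measureReal_union_le _ _
    _ ≤ _ := by linarith

/-- Fatou's lemma for indicators: {|y| > r} is open, so its indicator at the limit is at most the
liminf of the indicators. -/
theorem measure_lt_abs_le_of_tendsto_ae {Ω : Type*} [MeasurableSpace Ω] {P : Measure Ω}
    {Z : ℕ → Ω → ℝ} {Y : Ω → ℝ} (hZ : ∀ n, AEMeasurable (Z n) P) (hY : AEMeasurable Y P)
    (h : ∀ᵐ ω ∂P, Tendsto (fun n => Z n ω) atTop (𝓝 (Y ω))) {r : ℝ} {B : ℝ≥0∞}
    (hB : ∀ᶠ n in atTop, P {ω | r < |Z n ω|} ≤ B) : P {ω | r < |Y ω|} ≤ B := by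
  set S : ℕ → Set Ω := fun n => {ω | r < |Z n ω|}
  have hS : ∀ n ω, ω ∈ S n ↔ r < |Z n ω| := fun n ω => Iff.rfl
  set T : Set Ω := {ω | r < |Y ω|}
  have hT : ∀ ω, ω ∈ T ↔ r < |Y ω| := fun ω => Iff.rfl
  have hTm : NullMeasurableSet T P := nullMeasurableSet_lt aemeasurable_const hY.abs
  have hSm : ∀ n, NullMeasurableSet (S n) P := fun n =>
    nullMeasurableSet_lt aemeasurable_const (hZ n).abs
  clear_value S T
  have hle : P T ≤ ∫⁻ ω, liminf (fun n => (S n).indicator (1 : Ω → ℝ≥0∞) ω) atTop ∂P := by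
    rw [← lintegral_indicator_one₀ hTm]
    refine lintegral_mono_ae ?_
    filter_upwards [h] with ω hω
    by_cases h1 : ω ∈ T
    · rw [indicator_of_mem h1]
      refine le_liminf_of_le (by isBoundedDefault) ?_
      filter_upwards [hω.abs.eventually_const_lt ((hT ω).1 h1)] with n hn
      rw [indicator_of_mem ((hS n ω).2 hn)]
    · rw [indicator_of_notMem h1]
      exact zero_le
  refine hle.trans ((lintegral_liminf_le' fun n => ?_).trans ?_)
  · exact aemeasurable_const.indicator₀ (hSm n)
  · refine liminf_le_of_frequently_le' (Eventually.frequently ?_)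
    filter_upwards [hB] with n hn
    rw [lintegral_indicator_one₀ (hSm n)]
    convert! hn using 2
    ext ω
    exact hS n ω

theorem eLpNorm_sum_mul_le {E J : Type*} [Fintype J] [MeasurableSpace E] {μ : Measure E}
    (d : J → ℝ) (g : J → E → ℝ) (hg : ∀ j, AEStronglyMeasurable (g j) μ) :
    eLpNorm (fun y => ∑ j, d j * g j y) 2 μ ≤ ∑ j, ‖d j‖ₑ * eLpNorm (g j) 2 μ := by
  have e : (fun y => ∑ j, d j * g j y) = ∑ j, d j • g j := by
    ext y; simp
  rw [e]
  refine (eLpNorm_sum_le (fun j _ => (hg j).const_smul (d j)) one_le_two).trans ?_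
  exact Finset.sum_le_sum fun j _ => by rw [eLpNorm_const_smul]

/-! ### Laws and tails of Wiener integrals. -/

section WhiteNoise

variable {E Ω : Type*} [MeasurableSpace E] [MeasurableSpace Ω] {μ : Measure E} {P : Measure Ω}
  {W : Set E → Ω → ℝ}

/-- The Itô isometry on indicators: both second moments expand into the same double sum, as E[W(A)
W(B)] = μ(A ∩ B) = ∫ 1_A 1_B dμ. -/
theorem IsWhiteNoise.map_sum_eq_gaussianReal [IsProbabilityMeasure P] (hW : IsWhiteNoise μ P W)
    {ι : Type*} (I : Finset ι) (c : ι → ℝ) (A : ι → {A : Set E // MeasurableSet A ∧ μ A ≠ ∞}) :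
    P.map (fun ω => ∑ i ∈ I, c i * W (A i) ω) =
      gaussianReal 0 (∫ y, (∑ i ∈ I, c i * (A i : Set E).indicator 1 y) ^ 2 ∂μ).toNNReal := by
  have hg : HasGaussianLaw (fun ω => ∑ i ∈ I, c i * W (A i) ω) P :=
    ((hW.isGaussianProcess.comp_right A).smul c).hasGaussianLaw_fun_sum
  have h2 : ∀ i, MemLp (W (A i)) 2 P := fun i =>
    (hW.isGaussianProcess.hasGaussianLaw_eval (A i)).memLp_two
  have hmean : ∫ ω, ∑ i ∈ I, c i * W (A i) ω ∂P = 0 := by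
    rw [integral_finsetSum _ fun i _ => ((h2 i).integrable one_le_two).const_mul _]
    refine Finset.sum_eq_zero fun i _ => ?_
    rw [integral_const_mul, hW.mean_zero _ (A i).2.1 (A i).2.2, mul_zero]
  rw [hg.map_eq_gaussianReal, hmean, variance_of_integral_eq_zero hg.aemeasurable hmean]
  congr 2
  have e1 : ∀ ω, (∑ i ∈ I, c i * W (A i) ω) ^ 2
      = ∑ i ∈ I, ∑ j ∈ I, c i * c j * (W (A i) ω * W (A j) ω) := by
    intro ω
    rw [sq, Finset.sum_mul_sum]
    exact Finset.sum_congr rfl fun i _ => Finset.sum_congr rfl fun j _ => by ring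
  have e2 : ∀ y, (∑ i ∈ I, c i * (A i : Set E).indicator (1 : E → ℝ) y) ^ 2
      = ∑ i ∈ I, ∑ j ∈ I, c i * c j * ((A i ∩ A j : Set E).indicator (1 : E → ℝ) y) := by
    intro y
    rw [sq, Finset.sum_mul_sum]
    refine Finset.sum_congr rfl fun i _ => Finset.sum_congr rfl fun j _ => ?_
    rw [inter_indicator_one, Pi.mul_apply]
    ring
  have i1 : ∀ i j, Integrable (fun ω => c i * c j * (W (A i) ω * W (A j) ω)) P := fun i j =>
    ((h2 i).integrable_mul (h2 j)).const_mul _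
  have hms : ∀ i j, MeasurableSet (A i ∩ A j : Set E) := fun i j => (A i).2.1.inter (A j).2.1
  have i2 : ∀ i j, Integrable
      (fun y => c i * c j * ((A i ∩ A j : Set E).indicator (1 : E → ℝ) y)) μ := fun i j =>
    ((integrable_indicator_iff (hms i j)).2 (integrableOn_const
      (ne_top_of_le_ne_top (A i).2.2 (measure_mono inter_subset_left)))).const_mul _
  simp_rw [e1, e2]
  rw [integral_finsetSum _ fun i _ => integrable_finsetSum _ fun j _ => i1 i j,
    integral_finsetSum _ fun i _ => integrable_finsetSum _ fun j _ => i2 i j]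
  refine Finset.sum_congr rfl fun i _ => ?_
  rw [integral_finsetSum _ fun j _ => i1 i j, integral_finsetSum _ fun j _ => i2 i j]
  refine Finset.sum_congr rfl fun j _ => ?_
  rw [integral_const_mul, integral_const_mul,
    hW.covariance _ _ (A i).2.1 (A i).2.2 (A j).2.1 (A j).2.2, integral_indicator_one (hms i j)]
  rfl

/-- The level set `{φ = c}` of a square-integrable simple function, replaced by `∅` if `c = 0`. -/
noncomputable def levelSet (φ : SimpleFunc E ℝ) (hφ : MemLp φ 2 μ) (c : ℝ) :
    {A : Set E // MeasurableSet A ∧ μ A ≠ ∞} :=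
  -- The zero level set may have infinite measure, where `W` is uncontrolled; its coefficient is 0,
  -- so any admissible set can replace it.
  if h : c = 0 then ⟨∅, by simp⟩ else
    ⟨φ ⁻¹' {c}, φ.measurableSet_preimage _,
      (SimpleFunc.measure_preimage_lt_top_of_memLp two_ne_zero ENNReal.ofNat_ne_top φ hφ c h).ne⟩

theorem mul_comp_levelSet {F : Type*} (g : Set E → F → ℝ) (φ : SimpleFunc E ℝ)
    (hφ : MemLp φ 2 μ) (c : ℝ) (x : F) :
    c * g (levelSet φ hφ c) x = c * g (φ ⁻¹' {c}) x := by
  by_cases h : c = 0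
  · simp [h]
  · simp [levelSet, h]

theorem sum_range_mul_indicator (φ : SimpleFunc E ℝ) (y : E) :
    ∑ c ∈ φ.range, c * (φ ⁻¹' {c}).indicator (1 : E → ℝ) y = φ y := by
  rw [Finset.sum_eq_single (φ y)]
  · simp
  · intro c _ hc
    rw [indicator_of_notMem (by simpa using fun h => hc h.symm), mul_zero]
  · intro h
    exact absurd (φ.mem_range_self y) h

/-- The pairs (j, c) form one finite family of sets, so several simple integrals are handled jointly
without proving that `simpleIntegral` is linear in the simple function. -/
theorem IsWhiteNoise.map_simpleIntegral [IsProbabilityMeasure P] (hW : IsWhiteNoise μ P W)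
    {J : Type*} [Fintype J] (d : J → ℝ) (φ : J → SimpleFunc E ℝ) (hφ : ∀ j, MemLp (φ j) 2 μ) :
    P.map (fun ω => ∑ j, d j * simpleIntegral W (φ j) ω) =
      gaussianReal 0 (∫ y, (∑ j, d j * φ j y) ^ 2 ∂μ).toNNReal := by
  have h := hW.map_sum_eq_gaussianReal (Finset.univ.sigma fun j => (φ j).range)
    (fun i : (_ : J) × ℝ => d i.1 * i.2) (fun i => levelSet (φ i.1) (hφ i.1) i.2)
  simp only [Finset.sum_sigma, mul_assoc] at h
  have e1 : ∀ ω, ∑ j, ∑ c ∈ (φ j).range, d j * (c * W (levelSet (φ j) (hφ j) c) ω)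
      = ∑ j, d j * simpleIntegral W (φ j) ω := by
    intro ω
    refine Finset.sum_congr rfl fun j _ => ?_
    rw [simpleIntegral, Finset.mul_sum]
    exact Finset.sum_congr rfl fun c _ => by rw [mul_comp_levelSet]
  have e2 : ∀ y, ∑ j, ∑ c ∈ (φ j).range, d j *
      (c * (levelSet (φ j) (hφ j) c : Set E).indicator (1 : E → ℝ) y) = ∑ j, d j * φ j y := by
    intro y
    refine Finset.sum_congr rfl fun j _ => ?_
    rw [← sum_range_mul_indicator (φ j) y, Finset.mul_sum]
    exact Finset.sum_congr rfl fun c _ => by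
      rw [mul_comp_levelSet (fun A y => A.indicator (1 : E → ℝ) y)]
  simp_rw [e1, e2] at h
  exact h

theorem IsWhiteNoise.measure_lt_abs_simpleIntegral_le [IsProbabilityMeasure P]
    (hW : IsWhiteNoise μ P W) {J : Type*} [Fintype J] (d : J → ℝ) (φ : J → SimpleFunc E ℝ)
    (hφ : ∀ j, MemLp (φ j) 2 μ) {σ r : ℝ} (hσ : 0 < σ) (hr : 0 ≤ r)
    (h : eLpNorm (fun y => ∑ j, d j * φ j y) 2 μ ≤ ENNReal.ofReal σ) :
    P {ω | r < |∑ j, d j * simpleIntegral W (φ j) ω|}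
      ≤ ENNReal.ofReal (2 * Real.exp (-r ^ 2 / (2 * σ ^ 2))) := by
  refine measure_lt_abs_le_of_map_eq_gaussianReal (hW.map_simpleIntegral d φ hφ) (by positivity)
    ?_ hr
  have hmem : MemLp (fun y => ∑ j, d j * φ j y) 2 μ :=
    memLp_finsetSum _ fun j _ => (hφ j).const_mul (d j)
  have h1 := hmem.eLpNorm_eq_integral_rpow_norm two_ne_zero ENNReal.ofNat_ne_top
  rw [h1, ENNReal.ofReal_le_ofReal_iff hσ.le] at h
  simp only [ENNReal.toReal_ofNat, Real.rpow_ofNat, Real.norm_eq_abs, sq_abs] at h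
  rw [← one_div, ← Real.sqrt_eq_rpow] at h
  have h0 : 0 ≤ ∫ y, (∑ j, d j * φ j y) ^ 2 ∂μ := integral_nonneg fun y => sq_nonneg _
  rw [Real.coe_toNNReal _ h0]
  exact (Real.sqrt_le_left hσ.le).1 h

/-- The tail bound passes from simple approximants to the limit along an a.e. convergent
subsequence. The strict inequality on the L² norm leaves room for the approximants to have norm at
most σ eventually. -/
theorem IsWhiteNoise.measure_lt_abs_wienerIntegral_le [IsProbabilityMeasure P]
    (hW : IsWhiteNoise μ P W) {J : Type*} [Fintype J] (d : J → ℝ) (f : J → E → ℝ)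
    (hf : ∀ j, AEStronglyMeasurable (f j) μ) (X : J → Ω → ℝ)
    (hX : ∀ j, IsWienerIntegral μ P W (f j) (X j)) {σ r : ℝ} (hσ : 0 < σ) (hr : 0 ≤ r)
    (h : eLpNorm (fun y => ∑ j, d j * f j y) 2 μ < ENNReal.ofReal σ) :
    P {ω | r < |∑ j, d j * X j ω|} ≤ ENNReal.ofReal (2 * Real.exp (-r ^ 2 / (2 * σ ^ 2))) := by
  choose hX2 φ hφ2 hφf hφX using hX
  have hd0 : ∀ j, ‖d j‖ₑ ≠ ∞ := fun j => enorm_ne_top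
  have lim0 : ∀ {ν : ℕ → J → ℝ≥0∞}, (∀ j, Tendsto (fun n => ν n j) atTop (𝓝 0)) →
      Tendsto (fun n => ∑ j, ‖d j‖ₑ * ν n j) atTop (𝓝 0) := by
    intro ν hν
    have := tendsto_finsetSum (Finset.univ : Finset J) fun j _ =>
      ENNReal.Tendsto.const_mul (hν j) (Or.inr (hd0 j))
    simpa using this
  have hIm : ∀ n j, AEStronglyMeasurable (simpleIntegral W (φ j n)) P := by
    intro n j
    have := hW.map_simpleIntegral (fun _ : Unit => 1) (fun _ => φ j n) (fun _ => hφ2 j n)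
    simp only [Finset.univ_unique, Finset.sum_singleton, one_mul] at this
    exact (aemeasurable_of_map_neZero (by rw [this]; infer_instance)).aestronglyMeasurable
  set Z : ℕ → Ω → ℝ := fun n ω => ∑ j, d j * simpleIntegral W (φ j n) ω with hZ
  set Y : Ω → ℝ := fun ω => ∑ j, d j * X j ω with hY
  have hconv : Tendsto (fun n => eLpNorm (Z n - Y) 2 P) atTop (𝓝 0) := by
    refine tendsto_of_tendsto_of_tendsto_of_le_of_le tendsto_const_nhds (lim0 hφX)
      (fun _ => zero_le) fun n => ?_
    have := eLpNorm_sum_mul_le (μ := P) d (fun j ω => simpleIntegral W (φ j n) ω - X j ω)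
      fun j => (hIm n j).sub (hX2 j).1
    refine le_trans (le_of_eq ?_) this
    congr 1; ext ω
    simp_rw [Pi.sub_apply, hZ, hY, mul_sub, Finset.sum_sub_distrib]
  have hvar : ∀ᶠ n in atTop,
      eLpNorm (fun y => ∑ j, d j * φ j n y) 2 μ ≤ ENNReal.ofReal σ := by
    have hl := (lim0 hφf).const_add (eLpNorm (fun y => ∑ j, d j * f j y) 2 μ)
    rw [add_zero] at hl
    filter_upwards [hl.eventually_lt_const h] with n hn
    refine le_trans ?_ hn.le
    have e : (fun y => ∑ j, d j * φ j n y) = (fun y => ∑ j, d j * f j y)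
        + fun y => ∑ j, d j * (φ j n y - f j y) := by
      ext y
      simp_rw [Pi.add_apply, mul_sub, Finset.sum_sub_distrib]
      ring
    rw [e]
    refine (eLpNorm_add_le ?_ ?_ one_le_two).trans ?_
    · exact Finset.aestronglyMeasurable_fun_sum _ fun j _ => (hf j).const_mul _
    · exact Finset.aestronglyMeasurable_fun_sum _ fun j _ =>
        ((φ j n).aestronglyMeasurable.sub (hf j)).const_mul _
    · gcongr
      exact eLpNorm_sum_mul_le d (fun j y => φ j n y - f j y) fun j => (φ j n).aestronglyMeasurable.sub (hf j)
  have hYm : AEStronglyMeasurable Y P :=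
    Finset.aestronglyMeasurable_fun_sum _ fun j _ => (hX2 j).1.const_mul _
  have hZm : ∀ n, AEStronglyMeasurable (Z n) P :=
    fun n => Finset.aestronglyMeasurable_fun_sum _ fun j _ => (hIm n j).const_mul _
  have hP : ∀ᶠ n in atTop, P {ω | r < |Z n ω|}
      ≤ ENNReal.ofReal (2 * Real.exp (-r ^ 2 / (2 * σ ^ 2))) := by
    filter_upwards [hvar] with n hn
    exact hW.measure_lt_abs_simpleIntegral_le d (fun j => φ j n) (fun j => hφ2 j n) hσ hr hn
  change P {ω | r < |Y ω|} ≤ _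
  clear_value Z Y
  obtain ⟨ns, hns, hae⟩ :=
    (tendstoInMeasure_of_tendsto_eLpNorm two_ne_zero hZm hYm hconv).exists_seq_tendsto_ae
  exact measure_lt_abs_le_of_tendsto_ae (fun k => (hZm (ns k)).aemeasurable) hYm.aemeasurable
    hae (hns.tendsto_atTop.eventually hP)

end WhiteNoise

/-! ### The kernel in light-cone coordinates. -/

/-- The smooth function that `kgKernel` restricts to the light cone, in light-cone coordinates. -/
noncomputable def smoothKernel (a m : ℝ) (y : ℝ × ℝ) : ℝ :=
  Real.exp (-a * ((y.1 + y.2) / 2) / 2) / 2 * kgSeries ((a ^ 2 / 4 - m ^ 2) * (y.1 * y.2) / 4)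

theorem contDiff_kgSeries : ContDiff ℝ 1 kgSeries := by
  have h : deriv kgSeries = kgSeriesAux := funext fun r => (kgSeries_hasDerivAt r).deriv
  exact contDiff_one_iff_deriv.2
    ⟨fun r => (kgSeries_hasDerivAt r).differentiableAt, h ▸ kgSeriesAux_continuous⟩

theorem contDiff_smoothKernel (a m : ℝ) : ContDiff ℝ 1 (smoothKernel a m) := by
  unfold smoothKernel
  exact ContDiff.mul (by fun_prop) (contDiff_kgSeries.comp (by fun_prop))

theorem exists_bound_smoothKernel (a m R : ℝ) : ∃ C : ℝ, 0 ≤ C ∧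
    (∀ y ∈ Icc 0 R ×ˢ Icc 0 R, |smoothKernel a m y| ≤ C) ∧
    ∀ y ∈ Icc 0 R ×ˢ Icc 0 R, ∀ z ∈ Icc 0 R ×ˢ Icc 0 R,
      |smoothKernel a m y - smoothKernel a m z| ≤ C * dist y z := by
  have hc : IsCompact (Icc (0 : ℝ) R ×ˢ Icc (0 : ℝ) R) := isCompact_Icc.prod isCompact_Icc
  obtain ⟨K, hK⟩ := LocallyLipschitzOn.exists_lipschitzOnWith_of_compact hc
    (contDiff_smoothKernel a m).locallyLipschitz.locallyLipschitzOn
  obtain ⟨B, hB⟩ := hc.exists_bound_of_continuousOn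
    (contDiff_smoothKernel a m).continuous.continuousOn
  refine ⟨max K B, le_max_of_le_left K.2, fun y hy => (hB y hy).trans (le_max_right _ _),
    fun y hy z hz => ?_⟩
  rw [← Real.dist_eq]
  refine (hK.dist_le_mul y hy z hz).trans ?_
  gcongr
  exact le_max_left _ _

/-- With t = (α + β)/2 and x = (α - β)/2, the cone |x| < t is the open quadrant and t² - x² = αβ. -/
theorem kgKernel_lightCone (a m α β : ℝ) :
    kgKernel a m ((α + β) / 2) ((α - β) / 2) =
      if 0 < α ∧ 0 < β then smoothKernel a m (α, β) else 0 := by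
  have h : |(α - β) / 2| < (α + β) / 2 ↔ 0 < α ∧ 0 < β := by
    rw [abs_lt]
    constructor
    · rintro ⟨h1, h2⟩; constructor <;> linarith
    · rintro ⟨h1, h2⟩; constructor <;> linarith
  simp only [kgKernel, h, smoothKernel]
  congr 4
  ring

/-! ### Pointwise increments of a Lipschitz function cut off to a quadrant. -/

section Cutoff

variable {g : ℝ × ℝ → ℝ} {C R : ℝ}

/-- The weight of the strip `p₁ ≤ ξ < p₂` in the increment bounds, at `α = p - ξ`. -/
noncomputable def crossing (α₁ α₂ : ℝ) : ℝ := α₂ - α₁ + if α₁ ≤ 0 ∧ 0 < α₂ then 1 else 0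

theorem crossing_nonneg {α₁ α₂ : ℝ} (h : α₁ ≤ α₂) : 0 ≤ crossing α₁ α₂ := by
  unfold crossing
  split_ifs <;> linarith

/-- If the edge is crossed, only the bound C is available and `crossing` is at least 1. Otherwise
the Lipschitz bound applies, and (α₂ - α₁)² ≤ R (α₂ - α₁). -/
theorem sq_cutoff_sub_le (hC : 0 ≤ C) (hR : 1 ≤ R)
    (hb : ∀ y ∈ Icc 0 R ×ˢ Icc 0 R, |g y| ≤ C)
    (hl : ∀ y ∈ Icc 0 R ×ˢ Icc 0 R, ∀ z ∈ Icc 0 R ×ˢ Icc 0 R, |g y - g z| ≤ C * dist y z)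
    {α₁ α₂ β : ℝ} (hα : α₁ ≤ α₂) (hαR : α₂ ≤ R) (hβR : β ≤ R) :
    ((if 0 < α₂ ∧ 0 < β then g (α₂, β) else 0) - (if 0 < α₁ ∧ 0 < β then g (α₁, β) else 0)) ^ 2
      ≤ 4 * C ^ 2 * R * crossing α₁ α₂ := by
  have hX := crossing_nonneg hα
  rcases le_or_gt β 0 with hβ | hβ
  · simp only [not_lt.2 hβ, and_false, if_false, sub_zero]
    rw [zero_pow two_ne_zero]
    positivity
  rcases le_or_gt α₂ 0 with h2 | h2
  · have h1 := hα.trans h2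
    simp only [not_lt.2 h1, not_lt.2 h2, false_and, if_false, sub_zero]
    rw [zero_pow two_ne_zero]
    positivity
  have m2 : (α₂, β) ∈ Icc 0 R ×ˢ Icc 0 R := ⟨⟨h2.le, hαR⟩, ⟨hβ.le, hβR⟩⟩
  rcases le_or_gt α₁ 0 with h1 | h1
  · simp only [not_lt.2 h1, h2, hβ, false_and, true_and, if_false, if_true, sub_zero, crossing, h1]
    have h3 : g (α₂, β) ^ 2 ≤ C ^ 2 := sq_le_sq.2 (by rw [abs_of_nonneg hC]; exact hb _ m2)
    have h4 : (1 : ℝ) ≤ R * (α₂ - α₁ + 1) := by nlinarith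
    nlinarith [mul_le_mul_of_nonneg_left h4 (sq_nonneg C), sq_nonneg C]
  · have m1 : (α₁, β) ∈ Icc 0 R ×ˢ Icc 0 R := ⟨⟨h1.le, hα.trans hαR⟩, ⟨hβ.le, hβR⟩⟩
    simp only [h1, h2, hβ, true_and, if_true, crossing, not_le.2 h1, false_and, if_false, add_zero]
    have h3 := hl _ m2 _ m1
    rw [Prod.dist_eq, dist_self, max_eq_left dist_nonneg, Real.dist_eq,
      abs_of_nonneg (sub_nonneg.2 hα)] at h3
    have h4 : (g (α₂, β) - g (α₁, β)) ^ 2 ≤ (C * (α₂ - α₁)) ^ 2 :=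
      sq_le_sq.2 (h3.trans (le_abs_self _))
    have h5 : (α₂ - α₁) ^ 2 ≤ R * (α₂ - α₁) := by nlinarith
    nlinarith [mul_le_mul_of_nonneg_left h5 (sq_nonneg C),
      mul_nonneg (sq_nonneg C) (mul_nonneg (zero_le_one.trans hR) (sub_nonneg.2 hα))]

/-- The cases are which of the two edges are crossed. When neither is, the rectangular difference is
at most 2C(α₂ - α₁) and at most 2C(β₂ - β₁), hence its square is at most the product; Lipschitz
regularity thus suffices, with no mixed second derivative. -/
theorem sq_cutoff_rect_le (hC : 0 ≤ C) (hR : 1 ≤ R)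
    (hb : ∀ y ∈ Icc 0 R ×ˢ Icc 0 R, |g y| ≤ C)
    (hl : ∀ y ∈ Icc 0 R ×ˢ Icc 0 R, ∀ z ∈ Icc 0 R ×ˢ Icc 0 R, |g y - g z| ≤ C * dist y z)
    {α₁ α₂ β₁ β₂ : ℝ} (hα : α₁ ≤ α₂) (hαR : α₂ ≤ R) (hβ : β₁ ≤ β₂) (hβR : β₂ ≤ R) :
    ((if 0 < α₂ ∧ 0 < β₂ then g (α₂, β₂) else 0) - (if 0 < α₁ ∧ 0 < β₂ then g (α₁, β₂) else 0)
      - (if 0 < α₂ ∧ 0 < β₁ then g (α₂, β₁) else 0)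
      + (if 0 < α₁ ∧ 0 < β₁ then g (α₁, β₁) else 0)) ^ 2
      ≤ 4 * C ^ 2 * R * (crossing α₁ α₂ * crossing β₁ β₂) := by
  have hX := crossing_nonneg hα
  have hY := crossing_nonneg hβ
  have hR0 : 0 ≤ R := zero_le_one.trans hR
  have fst_le : ∀ {x x' y : ℝ}, x ∈ Icc 0 R → x' ∈ Icc 0 R → y ∈ Icc 0 R → x ≤ x' →
      |g (x', y) - g (x, y)| ≤ C * (x' - x) := by
    intro x x' y hx hx' hy hxx
    have := hl (x', y) ⟨hx', hy⟩ (x, y) ⟨hx, hy⟩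
    rwa [Prod.dist_eq, dist_self, max_eq_left dist_nonneg, Real.dist_eq,
      abs_of_nonneg (sub_nonneg.2 hxx)] at this
  have snd_le : ∀ {x y y' : ℝ}, x ∈ Icc 0 R → y ∈ Icc 0 R → y' ∈ Icc 0 R → y ≤ y' →
      |g (x, y') - g (x, y)| ≤ C * (y' - y) := by
    intro x y y' hx hy hy' hyy
    have := hl (x, y') ⟨hx, hy'⟩ (x, y) ⟨hx, hy⟩
    rwa [Prod.dist_eq, dist_self, max_eq_right dist_nonneg, Real.dist_eq,
      abs_of_nonneg (sub_nonneg.2 hyy)] at this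
  rcases le_or_gt α₂ 0 with h2 | h2
  · have h1 := hα.trans h2
    simp only [not_lt.2 h1, not_lt.2 h2, false_and, if_false, sub_zero, add_zero]
    rw [zero_pow two_ne_zero]
    positivity
  rcases le_or_gt β₂ 0 with k2 | k2
  · have k1 := hβ.trans k2
    simp only [not_lt.2 k1, not_lt.2 k2, and_false, if_false, sub_zero, add_zero]
    rw [zero_pow two_ne_zero]
    positivity
  have ma2 : α₂ ∈ Icc 0 R := ⟨h2.le, hαR⟩
  have mb2 : β₂ ∈ Icc 0 R := ⟨k2.le, hβR⟩
  have dα := sub_nonneg.2 hα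
  have dβ := sub_nonneg.2 hβ
  rcases le_or_gt α₁ 0 with h1 | h1 <;> rcases le_or_gt β₁ 0 with k1 | k1
  · simp only [not_lt.2 h1, not_lt.2 k1, h1, k1, h2, k2, and_false, and_true,
      if_false, if_true, sub_zero, add_zero, crossing]
    have h3 : g (α₂, β₂) ^ 2 ≤ C ^ 2 :=
      sq_le_sq.2 (by rw [abs_of_nonneg hC]; exact hb _ ⟨ma2, mb2⟩)
    have h4 : (1 : ℝ) ≤ (α₂ - α₁ + 1) * (β₂ - β₁ + 1) := by nlinarith
    have h5 : (1 : ℝ) ≤ R * ((α₂ - α₁ + 1) * (β₂ - β₁ + 1)) := by nlinarith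
    nlinarith [mul_le_mul_of_nonneg_left h5 (sq_nonneg C), sq_nonneg C]
  · have mb1 : β₁ ∈ Icc 0 R := ⟨k1.le, hβ.trans hβR⟩
    simp only [not_lt.2 h1, not_le.2 k1, h1, k1, h2, k2, false_and, true_and,
      if_false, if_true, sub_zero, add_zero, crossing]
    have h4 : (g (α₂, β₂) - g (α₂, β₁)) ^ 2 ≤ (C * (β₂ - β₁)) ^ 2 :=
      sq_le_sq.2 ((snd_le ma2 mb1 mb2 hβ).trans (le_abs_self _))
    have h5 : (β₂ - β₁) ^ 2 ≤ R * ((α₂ - α₁ + 1) * (β₂ - β₁)) := by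
      have e1 : (β₂ - β₁) ^ 2 ≤ R * (β₂ - β₁) := by nlinarith
      have e2 : 0 ≤ R * ((α₂ - α₁) * (β₂ - β₁)) := by positivity
      nlinarith
    have h6 : 0 ≤ C ^ 2 * (R * ((α₂ - α₁ + 1) * (β₂ - β₁))) := by positivity
    nlinarith [mul_le_mul_of_nonneg_left h5 (sq_nonneg C)]
  · have ma1 : α₁ ∈ Icc 0 R := ⟨h1.le, hα.trans hαR⟩
    simp only [not_lt.2 k1, not_le.2 h1, h1, k1, h2, k2, and_false, and_true,
      if_false, if_true, sub_zero, add_zero, crossing]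
    have h4 : (g (α₂, β₂) - g (α₁, β₂)) ^ 2 ≤ (C * (α₂ - α₁)) ^ 2 :=
      sq_le_sq.2 ((fst_le ma1 ma2 mb2 hα).trans (le_abs_self _))
    have h5 : (α₂ - α₁) ^ 2 ≤ R * ((α₂ - α₁) * (β₂ - β₁ + 1)) := by
      have e1 : (α₂ - α₁) ^ 2 ≤ R * (α₂ - α₁) := by nlinarith
      have e2 : 0 ≤ R * ((α₂ - α₁) * (β₂ - β₁)) := by positivity
      nlinarith
    have h6 : 0 ≤ C ^ 2 * (R * ((α₂ - α₁) * (β₂ - β₁ + 1))) := by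
      have : 0 ≤ β₂ - β₁ + 1 := by linarith
      positivity
    nlinarith [mul_le_mul_of_nonneg_left h5 (sq_nonneg C)]
  · have ma1 : α₁ ∈ Icc 0 R := ⟨h1.le, hα.trans hαR⟩
    have mb1 : β₁ ∈ Icc 0 R := ⟨k1.le, hβ.trans hβR⟩
    simp only [not_le.2 k1, not_le.2 h1, h1, k1, h2, k2, false_and, true_and,
      if_false, if_true, add_zero, crossing]
    have a1 := fst_le ma1 ma2 mb2 hα
    have a2 := fst_le ma1 ma2 mb1 hα
    have b1 := snd_le ma2 mb1 mb2 hβ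
    have b2 := snd_le ma1 mb1 mb2 hβ
    set D := g (α₂, β₂) - g (α₁, β₂) - g (α₂, β₁) + g (α₁, β₁) with hD
    have c1 : |D| ≤ 2 * C * (α₂ - α₁) := by
      rw [abs_le] at a1 a2 ⊢
      constructor <;> linarith
    have c2 : |D| ≤ 2 * C * (β₂ - β₁) := by
      rw [abs_le] at b1 b2 ⊢
      constructor <;> linarith
    have c3 : D ^ 2 ≤ (2 * C * (α₂ - α₁)) * (2 * C * (β₂ - β₁)) := by
      rw [← sq_abs, sq]
      exact mul_le_mul c1 c2 (abs_nonneg _) (by positivity)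
    have h6 : 0 ≤ C ^ 2 * ((α₂ - α₁) * (β₂ - β₁)) := by positivity
    nlinarith [mul_le_mul_of_nonneg_left hR h6]

end Cutoff

/-! ### L² increments of the cone kernels. -/

/-- The integrable weight that bounds the increment of a cut-off kernel from `p₁` to `p₂`. -/
noncomputable def stripWeight (M p₁ p₂ ξ : ℝ) : ℝ≥0∞ :=
  (Icc (-M) M).indicator (fun _ => ENNReal.ofReal (p₂ - p₁)) ξ + (Ico p₁ p₂).indicator 1 ξ

theorem measurable_stripWeight (M p₁ p₂ : ℝ) : Measurable (stripWeight M p₁ p₂) :=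
  (measurable_const.indicator measurableSet_Icc).add (measurable_one.indicator measurableSet_Ico)

theorem lintegral_stripWeight {M : ℝ} (hM : 0 ≤ M) (p₁ p₂ : ℝ) :
    ∫⁻ ξ, stripWeight M p₁ p₂ ξ = ENNReal.ofReal ((2 * M + 1) * (p₂ - p₁)) := by
  unfold stripWeight
  rw [lintegral_add_left (measurable_const.indicator measurableSet_Icc),
    lintegral_indicator_const measurableSet_Icc, lintegral_indicator_one measurableSet_Ico,
    Real.volume_Icc, Real.volume_Ico, ENNReal.ofReal_mul (by linarith),
    ENNReal.ofReal_add (by linarith) zero_le_one, add_mul, ENNReal.ofReal_one, one_mul, mul_comm]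
  congr 3
  ring

theorem ofReal_crossing_le_stripWeight {M p₁ p₂ ξ : ℝ} (h : ξ ∈ Icc (-M) M) :
    ENNReal.ofReal (crossing (p₁ - ξ) (p₂ - ξ)) ≤ stripWeight M p₁ p₂ ξ := by
  unfold crossing stripWeight
  rw [indicator_of_mem h]
  refine (ENNReal.ofReal_add_le).trans (add_le_add (le_of_eq (by congr 1; ring)) ?_)
  split_ifs with h1
  · rw [indicator_of_mem (show ξ ∈ Ico p₁ p₂ from ⟨by linarith, by linarith⟩)]
    simp
  · simp

/-- Change to light-cone coordinates, where the dominating function is a product and Tonelli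
applies. The Jacobian 1/2 is discarded. -/
theorem lintegral_spaceTime_le {F : ℝ × ℝ → ℝ≥0∞} {A : ℝ≥0∞} {S T : ℝ → ℝ≥0∞}
    (hS : Measurable S) (hT : Measurable T)
    (h : ∀ ξ η, 0 ≤ ξ + η → F ((ξ + η) / 2, (ξ - η) / 2) ≤ A * (S ξ * T η)) :
    ∫⁻ y, F y ∂spaceTime ≤ A * ((∫⁻ ξ, S ξ) * ∫⁻ η, T η) := by
  have hs : MeasurableSet (Ici (0 : ℝ) ×ˢ (univ : Set ℝ)) := measurableSet_Ici.prod .univ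
  have himg : lc '' univ = univ := by
    refine image_univ_of_surjective fun y => ⟨(y.1 + y.2, y.1 - y.2), ?_⟩
    rw [lc_apply]
    ext <;> simp
  rw [spaceTime, ← lintegral_indicator hs, ← setLIntegral_univ, ← himg,
    lintegral_image_eq_lintegral_abs_det_fderiv_mul volume .univ
      (fun x _ => lc.hasFDerivAt.hasFDerivWithinAt) lc_injective.injOn, setLIntegral_univ,
    ← lintegral_prod_mul hS.aemeasurable hT.aemeasurable, ← lintegral_const_mul _ (by fun_prop),
    Measure.volume_eq_prod]
  refine lintegral_mono fun y => ?_
  rw [lc_det, lc_apply]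
  refine (mul_le_of_le_one_left' ?_).trans ?_
  · exact ENNReal.ofReal_le_one.2 (by norm_num)
  by_cases hy : 0 ≤ y.1 + y.2
  · exact (indicator_le_self' (fun _ _ => zero_le) _).trans (h y.1 y.2 hy)
  · rw [indicator_of_notMem]
    · exact zero_le
    · simp only [mem_prod, mem_Ici, mem_univ, and_true]
      intro h0
      exact hy (by linarith)

theorem eLpNorm_two_le_of_lintegral_le {E : Type*} [MeasurableSpace E] {μ : Measure E} {f : E → ℝ}
    {B : ℝ} (hB : 0 ≤ B) (h : ∫⁻ y, ENNReal.ofReal (f y ^ 2) ∂μ ≤ ENNReal.ofReal B) :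
    eLpNorm f 2 μ ≤ ENNReal.ofReal √B := by
  rw [eLpNorm_eq_lintegral_rpow_enorm_toReal two_ne_zero ENNReal.ofNat_ne_top]
  simp only [ENNReal.toReal_ofNat, ENNReal.rpow_ofNat, one_div]
  have e : ∀ y, ‖f y‖ₑ ^ 2 = ENNReal.ofReal (f y ^ 2) := fun y => by
    rw [← ofReal_norm, ← ENNReal.ofReal_pow (norm_nonneg _), Real.norm_eq_abs, sq_abs]
  simp_rw [e]
  refine (ENNReal.rpow_le_rpow h (by norm_num)).trans (le_of_eq ?_)
  rw [ENNReal.ofReal_rpow_of_nonneg hB (by norm_num), Real.sqrt_eq_rpow, one_div]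

/-- The integrand of `u(t, x)` with `t + x = p` and `t - x = q`. -/
noncomputable def coneKernel (a m p q : ℝ) (y : ℝ × ℝ) : ℝ :=
  kgKernel a m ((p + q) / 2 - y.1) ((p - q) / 2 - y.2)

theorem coneKernel_apply (a m p q ξ η : ℝ) :
    coneKernel a m p q ((ξ + η) / 2, (ξ - η) / 2) =
      if 0 < p - ξ ∧ 0 < q - η then smoothKernel a m (p - ξ, q - η) else 0 := by
  rw [← kgKernel_lightCone, coneKernel]
  congr 1 <;> ring

theorem measurable_coneKernel (a m p q : ℝ) : Measurable (coneKernel a m p q) := by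
  have h := kgSeries_continuous.measurable
  unfold coneKernel kgKernel
  exact Measurable.ite (measurableSet_lt (by fun_prop) (by fun_prop)) (by fun_prop) (by fun_prop)

/-- The integrands are supported in a bounded set: ξ + η ≥ 0 with ξ, η < M forces both into [-M, M],
so kernel arguments stay below R = 2M. -/
theorem exists_eLpNorm_coneKernel_le (a m : ℝ) {M : ℝ} (hM : 1 ≤ M) : ∃ C : ℝ, 0 ≤ C ∧
    (∀ p₁ p₂ q, p₁ ≤ p₂ → p₂ ≤ M → q ≤ M →
      eLpNorm (fun y => coneKernel a m p₂ q y - coneKernel a m p₁ q y) 2 spaceTime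
        ≤ ENNReal.ofReal √(C * (p₂ - p₁))) ∧
    ∀ p₁ p₂ q₁ q₂, p₁ ≤ p₂ → p₂ ≤ M → q₁ ≤ q₂ → q₂ ≤ M →
      eLpNorm (fun y => coneKernel a m p₂ q₂ y - coneKernel a m p₁ q₂ y
        - coneKernel a m p₂ q₁ y + coneKernel a m p₁ q₁ y) 2 spaceTime
        ≤ ENNReal.ofReal √(C * ((p₂ - p₁) * (q₂ - q₁))) := by
  obtain ⟨C, hC, hb, hl⟩ := exists_bound_smoothKernel a m (2 * M)
  have hR : 1 ≤ 2 * M := by linarith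
  have hM0 : 0 ≤ M := by linarith
  set A := 4 * C ^ 2 * (2 * M) with hA
  have hA0 : 0 ≤ A := by positivity
  have hB0 : 0 ≤ (2 * M + 1) ^ 2 := by positivity
  refine ⟨A * (2 * M + 1) ^ 2, by positivity, ?_, ?_⟩
  · intro p₁ p₂ q hp hpM hqM
    have hd := sub_nonneg.2 hp
    refine eLpNorm_two_le_of_lintegral_le (by positivity) ?_
    refine (lintegral_spaceTime_le (A := ENNReal.ofReal A) (measurable_stripWeight M p₁ p₂)
      (T := (Icc (-M) M).indicator 1) (measurable_one.indicator measurableSet_Icc) ?_).trans ?_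
    · intro ξ η h0
      simp only [coneKernel_apply]
      by_cases h1 : ξ < p₂ ∧ η < q
      · have mξ : ξ ∈ Icc (-M) M := ⟨by linarith, by linarith⟩
        have mη : η ∈ Icc (-M) M := ⟨by linarith, by linarith⟩
        rw [indicator_of_mem mη, Pi.one_apply, mul_one]
        have := sq_cutoff_sub_le (α₁ := p₁ - ξ) (α₂ := p₂ - ξ) (β := q - η) hC hR hb hl
          (by linarith) (by linarith [mξ.1]) (by linarith [mη.1])
        refine (ENNReal.ofReal_le_ofReal this).trans ?_
        rw [ENNReal.ofReal_mul hA0]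
        gcongr
        exact ofReal_crossing_le_stripWeight mξ
      · rw [if_neg, if_neg]
        · simp
        · exact fun h => h1 ⟨by linarith, by linarith⟩
        · exact fun h => h1 ⟨by linarith, by linarith⟩
    · rw [lintegral_stripWeight hM0, lintegral_indicator_one measurableSet_Icc, Real.volume_Icc,
        ← ENNReal.ofReal_mul (by positivity), ← ENNReal.ofReal_mul hA0]
      refine ENNReal.ofReal_le_ofReal ?_
      have : 0 ≤ A * (2 * M + 1) * (p₂ - p₁) := by positivity
      nlinarith
  · intro p₁ p₂ q₁ q₂ hp hpM hq hqM
    have hd := sub_nonneg.2 hp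
    have hd' := sub_nonneg.2 hq
    refine eLpNorm_two_le_of_lintegral_le (by positivity) ?_
    refine (lintegral_spaceTime_le (A := ENNReal.ofReal A) (measurable_stripWeight M p₁ p₂)
      (measurable_stripWeight M q₁ q₂) ?_).trans ?_
    · intro ξ η h0
      simp only [coneKernel_apply]
      by_cases h1 : ξ < p₂ ∧ η < q₂
      · have mξ : ξ ∈ Icc (-M) M := ⟨by linarith, by linarith⟩
        have mη : η ∈ Icc (-M) M := ⟨by linarith, by linarith⟩
        have := sq_cutoff_rect_le (α₁ := p₁ - ξ) (α₂ := p₂ - ξ) (β₁ := q₁ - η) (β₂ := q₂ - η)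
          hC hR hb hl (by linarith) (by linarith [mξ.1]) (by linarith) (by linarith [mη.1])
        refine (ENNReal.ofReal_le_ofReal this).trans ?_
        rw [ENNReal.ofReal_mul hA0, ENNReal.ofReal_mul (crossing_nonneg (by linarith))]
        gcongr
        · exact ofReal_crossing_le_stripWeight mξ
        · exact ofReal_crossing_le_stripWeight mη
      · rw [if_neg, if_neg, if_neg, if_neg]
        · simp
        all_goals exact fun h => h1 ⟨by linarith, by linarith⟩
    · rw [lintegral_stripWeight hM0, lintegral_stripWeight hM0,
        ← ENNReal.ofReal_mul (by positivity), ← ENNReal.ofReal_mul hA0]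
      refine ENNReal.ofReal_le_ofReal (le_of_eq ?_)
      ring

/-! ### Dyadic chaining -/

/-- The chain follows the dyadic truncations of (s, v), starting at (0, 0) where X vanishes. Halving
an index at level k + 1 gives the truncation at level k, and continuity closes the chain. -/
theorem abs_le_of_dyadic_increments_le {X : ℝ → ℝ → ℝ} (h0 : X 0 0 = 0)
    (hX : ContinuousOn (fun y : ℝ × ℝ => X y.1 y.2) (Ico 0 1 ×ˢ Ico 0 1)) {b : ℕ → ℝ} {S : ℝ}
    (hb : ∀ k, ∑ i ∈ Finset.range k, b i ≤ S)
    (h : ∀ k i j : ℕ, i < 2 ^ (k + 1) → j < 2 ^ (k + 1) →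
      |X (i / 2 ^ (k + 1)) (j / 2 ^ (k + 1)) - X ((i / 2 : ℕ) / 2 ^ k) ((j / 2 : ℕ) / 2 ^ k)| ≤ b k)
    {s v : ℝ} (hs : s ∈ Ico 0 1) (hv : v ∈ Ico 0 1) : |X s v| ≤ S := by
  set D : ℕ → ℝ → ℝ := fun k x => (⌊x * 2 ^ k⌋₊ : ℝ) / 2 ^ k with hD
  have half : ∀ k x, ⌊x * 2 ^ (k + 1)⌋₊ / 2 = ⌊x * (2 : ℝ) ^ k⌋₊ := by
    intro k x
    rw [← Nat.floor_div_ofNat, pow_succ, ← mul_assoc, mul_div_cancel_right₀ _ two_ne_zero]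
  have lt : ∀ k x, x ∈ Ico (0 : ℝ) 1 → ⌊x * (2 : ℝ) ^ k⌋₊ < 2 ^ k := by
    intro k x hx
    rw [Nat.floor_lt (mul_nonneg hx.1 (by positivity))]
    push_cast
    exact mul_lt_of_lt_one_left (by positivity) hx.2
  have mem : ∀ k x, x ∈ Ico (0 : ℝ) 1 → D k x ∈ Ico (0 : ℝ) 1 := by
    intro k x hx
    refine ⟨by positivity, ?_⟩
    rw [div_lt_one (by positivity)]
    exact_mod_cast lt k x hx
  have lim : ∀ x, x ∈ Ico (0 : ℝ) 1 → Tendsto (fun k => D k x) atTop (𝓝 x) := fun x hx =>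
    (tendsto_nat_floor_mul_div_atTop hx.1).comp (tendsto_pow_atTop_atTop_of_one_lt one_lt_two)
  have bound : ∀ k, |X (D k s) (D k v)| ≤ ∑ i ∈ Finset.range k, b i := by
    intro k
    induction k with
    | zero =>
      have e : ∀ x ∈ Ico (0 : ℝ) 1, D 0 x = 0 := fun x hx => by
        have h1 : ⌊x * (2 : ℝ) ^ 0⌋₊ = 0 := Nat.lt_one_iff.1 (lt 0 x hx)
        simp only [hD, h1]
        simp
      rw [e s hs, e v hv, h0]
      simp
    | succ k ih =>
      have h1 := h k _ _ (lt (k + 1) s hs) (lt (k + 1) v hv)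
      rw [half, half] at h1
      rw [Finset.sum_range_succ]
      have h2 := abs_sub_abs_le_abs_sub (X (D (k + 1) s) (D (k + 1) v)) (X (D k s) (D k v))
      simp only [hD] at h2 ih ⊢
      linarith
  have hlim : Tendsto (fun k => X (D k s) (D k v)) atTop (𝓝 (X s v)) := by
    have h1 := hX (s, v) ⟨hs, hv⟩
    refine h1.tendsto.comp (tendsto_nhdsWithin_iff.2 ⟨(lim s hs).prodMk_nhds (lim v hv), ?_⟩)
    exact Eventually.of_forall fun k => ⟨mem k s hs, mem k v hv⟩
  exact le_of_tendsto hlim.abs (Eventually.of_forall fun k => (bound k).trans (hb k))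

/-- The sum of the normalized increments along a dyadic chain. -/
noncomputable def chainingConst : ℝ := ∑' k : ℕ, ((k : ℝ) + 1) * √(1 / 2) ^ (k + 1)

theorem summable_chainingConst : Summable fun k : ℕ => ((k : ℝ) + 1) * √(1 / 2) ^ (k + 1) := by
  have h : ‖√(1 / 2 : ℝ)‖ < 1 := by
    rw [Real.norm_eq_abs, abs_of_nonneg (Real.sqrt_nonneg _), Real.sqrt_lt' one_pos]
    norm_num
  have h1 := summable_pow_mul_geometric_of_norm_lt_one 1 h
  have h2 := (summable_nat_add_iff (f := fun k : ℕ => (k : ℝ) ^ 1 * √(1 / 2) ^ k) 1).2 h1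
  refine h2.congr fun k => ?_
  rw [pow_one, Nat.cast_add, Nat.cast_one]

theorem chainingConst_pos : 0 < chainingConst :=
  summable_chainingConst.tsum_pos (fun k => by positivity) 0 (by positivity)

/-- Since (k + 1)² ≥ k + 1, the sum is dominated by a geometric one of ratio q = 4 exp(-L); L ≥ 3
gives q ≤ 1/2, and 2q/(1 - q) ≤ 4q. -/
theorem tsum_ofReal_chaining_le {L : ℝ} (hL : 3 ≤ L) :
    ∑' k : ℕ, (4 : ℝ≥0∞) ^ (k + 1) * ENNReal.ofReal (2 * Real.exp (-(L * (k + 1) ^ 2)))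
      ≤ ENNReal.ofReal (16 * Real.exp (-L)) := by
  set q := 4 * Real.exp (-L) with hq
  have hq0 : 0 < q := by positivity
  have hq1 : q ≤ 1 / 2 := by
    have h1 : (8 : ℝ) ≤ Real.exp L := by
      have e : (2 : ℝ) ≤ Real.exp 1 := by linarith [Real.add_one_le_exp (1 : ℝ)]
      calc (8 : ℝ) = 2 ^ 3 := by norm_num
        _ ≤ Real.exp 1 ^ 3 := by gcongr
        _ = Real.exp 3 := by rw [← Real.exp_nat_mul]; norm_num
        _ ≤ Real.exp L := Real.exp_le_exp.2 hL
    rw [hq, Real.exp_neg, ← div_eq_mul_inv, div_le_div_iff₀ (by positivity) two_pos]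
    linarith
  have hterm : ∀ k : ℕ, (4 : ℝ≥0∞) ^ (k + 1) * ENNReal.ofReal (2 * Real.exp (-(L * (k + 1) ^ 2)))
      ≤ ENNReal.ofReal (2 * q * q ^ k) := by
    intro k
    have e4 : (4 : ℝ≥0∞) ^ (k + 1) = ENNReal.ofReal (4 ^ (k + 1)) := by
      rw [ENNReal.ofReal_pow (by norm_num)]; norm_num
    rw [e4, ← ENNReal.ofReal_mul (by positivity)]
    refine ENNReal.ofReal_le_ofReal ?_
    have e1 : Real.exp (-(L * ((k : ℝ) + 1) ^ 2)) ≤ Real.exp (-L) ^ (k + 1) := by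
      rw [← Real.exp_nat_mul, Real.exp_le_exp]
      push_cast
      have : 0 ≤ L * (((k : ℝ) + 1) * k) := by positivity
      nlinarith
    calc 4 ^ (k + 1) * (2 * Real.exp (-(L * ((k : ℝ) + 1) ^ 2)))
        ≤ 4 ^ (k + 1) * (2 * Real.exp (-L) ^ (k + 1)) := by gcongr
      _ = 2 * q * q ^ k := by rw [hq, mul_pow]; ring
  have hs : Summable fun k : ℕ => 2 * q * q ^ k :=
    (summable_geometric_of_lt_one hq0.le (by linarith)).mul_left _
  refine (ENNReal.tsum_le_tsum hterm).trans ?_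
  rw [← ENNReal.ofReal_tsum_of_nonneg (fun k => by positivity) hs, tsum_mul_left,
    tsum_geometric_of_lt_one hq0.le (by linarith)]
  refine ENNReal.ofReal_le_ofReal ?_
  rw [← div_eq_mul_inv, div_le_iff₀ (by linarith)]
  nlinarith

theorem exists_measure_le_chaining {Ω : Type*} [MeasurableSpace Ω] {P : Measure Ω}
    {X : ℝ → ℝ → Ω → ℝ} {A L : ℝ} (hA : 0 < A) (hL : 3 ≤ L)
    (h : ∀ s' s v' v d r : ℝ, 0 ≤ s' → s' ≤ s → s < 1 → s ≤ s' + d → 0 ≤ v' → v' ≤ v → v < 1 →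
      v ≤ v' + d → 0 < d → 0 ≤ r →
      P {ω | r < |X s v ω - X s' v' ω|} ≤ ENNReal.ofReal (2 * Real.exp (-r ^ 2 / (2 * (A * d))))) :
    ∃ B : Set Ω, P B ≤ ENNReal.ofReal (16 * Real.exp (-L)) ∧ ∀ ω ∉ B, X 0 0 ω = 0 →
      ContinuousOn (fun y : ℝ × ℝ => X y.1 y.2 ω) (Ico 0 1 ×ˢ Ico 0 1) →
      ∀ s ∈ Ico (0 : ℝ) 1, ∀ v ∈ Ico (0 : ℝ) 1, |X s v ω| ≤ chainingConst * √(2 * A * L) := by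
  -- With d = 2^(-(k+1)), this threshold makes b_k²/(2Ad) = L(k + 1)², which beats the 4^(k+1) index
  -- pairs at each level while keeping b summable.
  set b : ℕ → ℝ := fun k => ((k : ℝ) + 1) * √(1 / 2) ^ (k + 1) * √(2 * A * L) with hb
  have hb0 : ∀ k, 0 ≤ b k := fun k => by positivity
  set B : ℕ → ℕ → ℕ → Set Ω := fun k i j => {ω | b k < |X (i / 2 ^ (k + 1)) (j / 2 ^ (k + 1)) ω
    - X ((i / 2 : ℕ) / 2 ^ k) ((j / 2 : ℕ) / 2 ^ k) ω|} with hB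
  refine ⟨⋃ k, ⋃ i ∈ Finset.range (2 ^ (k + 1)), ⋃ j ∈ Finset.range (2 ^ (k + 1)), B k i j, ?_, ?_⟩
  · have parent : ∀ k i : ℕ, i < 2 ^ (k + 1) → (0 : ℝ) ≤ (i / 2 : ℕ) / 2 ^ k ∧
        ((i / 2 : ℕ) : ℝ) / 2 ^ k ≤ i / 2 ^ (k + 1) ∧ (i : ℝ) / 2 ^ (k + 1) < 1 ∧
        (i : ℝ) / 2 ^ (k + 1) ≤ (i / 2 : ℕ) / 2 ^ k + (1 / 2) ^ (k + 1) := by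
      intro k i hi
      have e : ((i / 2 : ℕ) : ℝ) / 2 ^ k = ((2 * (i / 2) : ℕ) : ℝ) / 2 ^ (k + 1) := by
        push_cast; rw [pow_succ]; field_simp
      refine ⟨by positivity, ?_, ?_, ?_⟩
      · rw [e]
        gcongr
        omega
      · rw [div_lt_one (by positivity)]
        exact_mod_cast hi
      · rw [e, div_pow, one_pow, ← add_div]
        gcongr
        have : i ≤ 2 * (i / 2) + 1 := by omega
        exact_mod_cast this
    have hPB : ∀ k i j : ℕ, i < 2 ^ (k + 1) → j < 2 ^ (k + 1) →
        P (B k i j) ≤ ENNReal.ofReal (2 * Real.exp (-(L * (k + 1) ^ 2))) := by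
      intro k i j hi hj
      obtain ⟨i1, i2, i3, i4⟩ := parent k i hi
      obtain ⟨j1, j2, j3, j4⟩ := parent k j hj
      refine (h _ _ _ _ ((1 / 2) ^ (k + 1)) (b k) i1 i2 i3 i4 j1 j2 j3 j4 (by positivity)
        (hb0 k)).trans (le_of_eq ?_)
      congr 3
      have e : b k ^ 2 = ((k : ℝ) + 1) ^ 2 * (1 / 2) ^ (k + 1) * (2 * A * L) := by
        rw [hb, mul_pow, mul_pow, Real.sq_sqrt (by positivity), ← pow_mul, mul_comm (k + 1) 2,
          pow_mul, Real.sq_sqrt (by norm_num)]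
      rw [e]
      have : ((1 : ℝ) / 2) ^ (k + 1) ≠ 0 := by positivity
      field_simp
    refine (measure_iUnion_le _).trans (le_trans (ENNReal.tsum_le_tsum fun k => ?_)
      (tsum_ofReal_chaining_le hL))
    calc _ ≤ ∑ i ∈ Finset.range (2 ^ (k + 1)), ∑ j ∈ Finset.range (2 ^ (k + 1)),
          ENNReal.ofReal (2 * Real.exp (-(L * (k + 1) ^ 2))) := by
          refine (measure_biUnion_finset_le _ _).trans (Finset.sum_le_sum fun i hi => ?_)
          refine (measure_biUnion_finset_le _ _).trans (Finset.sum_le_sum fun j hj => ?_)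
          exact hPB k i j (Finset.mem_range.1 hi) (Finset.mem_range.1 hj)
      _ = _ := by
          simp only [Finset.sum_const, Finset.card_range, nsmul_eq_mul, ← mul_assoc]
          congr 1
          push_cast
          rw [← mul_pow]
          norm_num
  · intro ω hω h0 hc s hs v hv
    refine abs_le_of_dyadic_increments_le (X := fun s v => X s v ω) (b := b) h0 hc (fun k => ?_)
      (fun k i j hi hj => ?_) hs hv
    · rw [hb, ← Finset.sum_mul]
      gcongr
      exact summable_chainingConst.sum_le_tsum _ fun k _ => by positivity
    · by_contra hlt
      refine hω ?_
      simp only [mem_iUnion, Finset.mem_range]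
      exact ⟨k, i, hi, j, hj, not_le.1 hlt⟩

/-! ### Tails for the increments of u over a short range of p. -/

/-- The increment of `u` from `(p₀, q)` to `(p₀ + η s, q)`, `q = Q v`, in light-cone coordinates
`p = t + x`, `q = t - x`. -/
noncomputable def coneIncrement {Ω : Type*} (u : ℝ → ℝ → Ω → ℝ) (p₀ η Q s v : ℝ) (ω : Ω) : ℝ :=
  u ((p₀ + η * s + Q * v) / 2) ((p₀ + η * s - Q * v) / 2) ω
    - u ((p₀ + Q * v) / 2) ((p₀ - Q * v) / 2) ω

theorem exists_measure_lt_abs_coneIncrement_sub_le (a m : ℝ) {M Q : ℝ} (hM : 1 ≤ M) (hQ : 1 ≤ Q)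
    (hQM : Q ≤ M) : ∃ A : ℝ, 0 < A ∧ ∀ (Ω : Type*) [MeasurableSpace Ω] (P : Measure Ω)
      [IsProbabilityMeasure P] (W : Set (ℝ × ℝ) → Ω → ℝ) (u : ℝ → ℝ → Ω → ℝ),
      IsWhiteNoise spaceTime P W → IsMildSolution a m P W u →
      ∀ p₀ η, 0 ≤ p₀ → 0 < η → p₀ + η ≤ M →
      ∀ s' s v' v d r : ℝ, 0 ≤ s' → s' ≤ s → s < 1 → s ≤ s' + d → 0 ≤ v' → v' ≤ v → v < 1 →
      v ≤ v' + d → 0 < d → 0 ≤ r →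
      P {ω | r < |coneIncrement u p₀ η Q s v ω - coneIncrement u p₀ η Q s' v' ω|}
        ≤ ENNReal.ofReal (2 * Real.exp (-r ^ 2 / (2 * (A * η * d)))) := by
  obtain ⟨C, hC, h1, h2⟩ := exists_eLpNorm_coneKernel_le a m hM
  -- Two pieces of norm at most √(CQηd) add up to √(4CQηd); the extra 1 makes the inequality strict
  -- and the constant positive.
  refine ⟨4 * C * Q + 1, by positivity, ?_⟩
  intro Ω _ P _ W u hW hu p₀ η hp₀ hη hηM s' s v' v d r hs' hs hs1 hsd hv' hv hv1 hvd hd hr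
  have hQ0 : 0 ≤ Q := by linarith
  have hs0 := hs'.trans hs
  have hv0 := hv'.trans hv
  have b1 : η * s ≤ η := mul_le_of_le_one_right hη.le hs1.le
  have b2 : Q * v ≤ Q := mul_le_of_le_one_right hQ0 hv1.le
  have b3 : Q * v' ≤ Q * v := by gcongr
  have b4 : η * s' ≤ η * s := by gcongr
  have c1 : 0 ≤ η * s' := by positivity
  have c2 : 0 ≤ Q * v' := by positivity
  have hwi : ∀ p q, 0 ≤ p → 0 ≤ q → IsWienerIntegral spaceTime P W (coneKernel a m p q)
      (u ((p + q) / 2) ((p - q) / 2)) := fun p q hp hq => hu _ (by positivity) _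
  have hσ : 0 < (4 * C * Q + 1) * η * d := by positivity
  -- The difference is split into a rectangular increment over [p₀, p₀ + ηs] × [Qv', Qv] and an
  -- increment in p alone at q = Qv'. Each has squared norm O(ηd).
  have hnorm : eLpNorm (fun y => (coneKernel a m (p₀ + η * s) (Q * v) y
      - coneKernel a m p₀ (Q * v) y - coneKernel a m (p₀ + η * s) (Q * v') y
      + coneKernel a m p₀ (Q * v') y)
      + (coneKernel a m (p₀ + η * s) (Q * v') y - coneKernel a m (p₀ + η * s') (Q * v') y))
      2 spaceTime < ENNReal.ofReal √((4 * C * Q + 1) * η * d) := by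
    have mk := fun p q => (measurable_coneKernel a m p q).aestronglyMeasurable (μ := spaceTime)
    refine (eLpNorm_add_le ((((mk _ _).sub (mk _ _)).sub (mk _ _)).add (mk _ _))
      ((mk _ _).sub (mk _ _)) one_le_two).trans_lt ?_
    refine (add_le_add (h2 p₀ (p₀ + η * s) (Q * v') (Q * v) (by linarith) (by linarith) b3
      (by linarith)) (h1 (p₀ + η * s') (p₀ + η * s) (Q * v') (by linarith) (by linarith)
      (by linarith))).trans_lt ?_
    rw [← ENNReal.ofReal_add (Real.sqrt_nonneg _) (Real.sqrt_nonneg _)]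
    refine (ENNReal.ofReal_lt_ofReal_iff (Real.sqrt_pos.2 hσ)).2 ?_
    have e1 : √(C * ((p₀ + η * s - p₀) * (Q * v - Q * v'))) ≤ √(C * Q * (η * d)) := by
      refine Real.sqrt_le_sqrt ?_
      have f1 : p₀ + η * s - p₀ ≤ η := by linarith
      have f2 : Q * v - Q * v' ≤ Q * d := by
        rw [← mul_sub]
        gcongr
        linarith
      have f3 : (p₀ + η * s - p₀) * (Q * v - Q * v') ≤ η * (Q * d) :=
        mul_le_mul f1 f2 (by linarith) hη.le
      calc _ ≤ C * (η * (Q * d)) := by gcongr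
        _ = _ := by ring
    have e2 : √(C * (p₀ + η * s - (p₀ + η * s'))) ≤ √(C * Q * (η * d)) := by
      refine Real.sqrt_le_sqrt ?_
      have f2 : p₀ + η * s - (p₀ + η * s') ≤ η * d := by
        rw [add_sub_add_left_eq_sub, ← mul_sub]
        gcongr
        linarith
      calc _ ≤ C * (η * d) := by gcongr
        _ ≤ C * Q * (η * d) := by
          gcongr
          exact le_mul_of_one_le_right hC hQ
    refine (add_le_add e1 e2).trans_lt (Real.lt_sqrt_of_sq_lt ?_)
    rw [← two_mul, mul_pow, Real.sq_sqrt (by positivity)]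
    nlinarith [mul_pos hη hd]
  have key := hW.measure_lt_abs_wienerIntegral_le ![1, -1, -1, 1]
    ![coneKernel a m (p₀ + η * s) (Q * v), coneKernel a m p₀ (Q * v),
      coneKernel a m (p₀ + η * s') (Q * v'), coneKernel a m p₀ (Q * v')]
    (fun j => by
      fin_cases j <;> exact (measurable_coneKernel a m _ _).aestronglyMeasurable)
    ![u ((p₀ + η * s + Q * v) / 2) ((p₀ + η * s - Q * v) / 2),
      u ((p₀ + Q * v) / 2) ((p₀ - Q * v) / 2),
      u ((p₀ + η * s' + Q * v') / 2) ((p₀ + η * s' - Q * v') / 2),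
      u ((p₀ + Q * v') / 2) ((p₀ - Q * v') / 2)]
    (fun j => by
      fin_cases j <;> exact hwi _ _ (by linarith) (by linarith))
    (σ := √((4 * C * Q + 1) * η * d)) (Real.sqrt_pos.2 hσ) hr (by
      refine lt_of_eq_of_lt ?_ hnorm
      congr 1
      ext y
      simp [Fin.sum_univ_four]
      ring)
  rw [Real.sq_sqrt hσ.le] at key
  refine le_trans (le_of_eq ?_) key
  congr 2
  ext ω
  simp [Fin.sum_univ_four, coneIncrement]
  ring_nf

/-! ### Borel–Cantelli over dyadic scales. -/

theorem log_le_two_mul_log_log {n : ℕ} (hn : 4 ≤ n) {h : ℝ}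
    (h1 : (2 : ℝ) ^ n ≤ 1 / h) : Real.log n ≤ 2 * Real.log (Real.log (1 / h)) := by
  have hn' : (4 : ℝ) ≤ n := by exact_mod_cast hn
  have e1 : (n : ℝ) * Real.log 2 ≤ Real.log (1 / h) := by
    rw [← Real.log_pow]
    exact Real.log_le_log (by positivity) h1
  -- Replacing n log 2 by √n absorbs the constant log 2 and costs exactly the factor 2.
  have e2 : √n ≤ n * Real.log 2 := by
    have f1 : (1 : ℝ) / 2 ≤ Real.log 2 := by linarith [Real.log_two_gt_d9]
    have f2 : (2 : ℝ) ≤ √n := Real.le_sqrt_of_sq_le (by linarith)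
    have f3 : √n * √n = n := Real.mul_self_sqrt (by positivity)
    nlinarith
  have e3 : Real.log √n ≤ Real.log (Real.log (1 / h)) :=
    Real.log_le_log (Real.sqrt_pos.2 (by linarith)) (e2.trans e1)
  rw [Real.log_sqrt (by positivity)] at e3
  linarith

end KleinGordon

theorem theorem3 (a m N a₁ a₂ : ℝ) (hN : 0 < N) (ha₁ : 0 < a₁) (ha₂ : a₁ < a₂) :
    ∃ K₂ : ℝ, 0 < K₂ ∧
      ∀ (Ω : Type*) [MeasurableSpace Ω] (P : Measure Ω) [IsProbabilityMeasure P]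
        (W : Set (ℝ × ℝ) → Ω → ℝ) (u : ℝ → ℝ → Ω → ℝ),
        KleinGordon.IsWhiteNoise KleinGordon.spaceTime P W →
        KleinGordon.IsMildSolution a m P W u →
        (∀ᵐ ω ∂P, ContinuousOn (fun y : ℝ × ℝ => u y.1 y.2 ω) (Ici (0 : ℝ) ×ˢ univ)) →
        ∀ z₀ ∈ Icc a₁ a₂, ∀ᵐ ω ∂P, ∀ w ∈ Icc 0 N,
          limsup (fun h : ℝ =>
            ((|u ((w + z₀) / √2 + h) ((-w + z₀) / √2 + h) ω
                - u ((w + z₀) / √2) ((-w + z₀) / √2) ω|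
              / √(h * Real.log (Real.log (1 / h))) : ℝ) : EReal)) (𝓝[>] 0) ≤ (K₂ : EReal) := by
  have h2 : √(2 : ℝ) * √2 = 2 := Real.mul_self_sqrt zero_le_two
  have h21 : (1 : ℝ) ≤ √2 := Real.one_le_sqrt.2 one_le_two
  have h20 : (0 : ℝ) < √2 := by positivity
  -- N + 1 rather than N, so that v = w/(N + 1) stays below 1 on the half-open square, even at w =
  -- N.
  set Q : ℝ := √2 * (N + 1) with hQ
  have hQ1 : 1 ≤ Q := by nlinarith
  have hQ0 : 0 < Q := by linarith
  have hQM : Q ≤ √2 * a₂ + 4 + Q := by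
    have : 0 < √2 * a₂ := mul_pos h20 (ha₁.trans ha₂)
    linarith
  obtain ⟨A, hA, htail⟩ := KleinGordon.exists_measure_lt_abs_coneIncrement_sub_le a m
    (hQ1.trans hQM) hQ1 hQM
  have hS := KleinGordon.chainingConst_pos
  set S := KleinGordon.chainingConst
  -- 64 = 16 · 2 · 2: the chaining bound at η = 4 · 2⁻ⁿ, L = 2 log n has 16A · 2⁻ⁿ log n under the
  -- root, and then 2⁻ⁿ ≤ 2h and log n ≤ 2 log log(1/h).
  refine ⟨S * √(64 * A), by positivity, ?_⟩
  intro Ω _ P _ W u hW hu hcont z₀ hz₀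
  set p₀ : ℝ := √2 * z₀ with hp₀
  have hp0 : 0 ≤ p₀ := mul_nonneg h20.le (ha₁.le.trans hz₀.1)
  set η : ℕ → ℝ := fun n => 4 * (1 / 2) ^ n with hη
  have hη0 : ∀ n, 0 < η n := fun n => by positivity
  have hη4 : ∀ n, η n ≤ 4 := fun n =>
    mul_le_of_le_one_right (by norm_num) (pow_le_one₀ (by norm_num) (by norm_num))
  have hB : ∀ n : ℕ, ∃ B : Set Ω, P B ≤ ENNReal.ofReal (16 * (1 / (n : ℝ) ^ 2)) ∧ (5 ≤ n →
      ∀ ω ∉ B, ContinuousOn (fun y : ℝ × ℝ => u y.1 y.2 ω) (Ici (0 : ℝ) ×ˢ univ) →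
      ∀ s ∈ Ico (0 : ℝ) 1, ∀ v ∈ Ico (0 : ℝ) 1, |KleinGordon.coneIncrement u p₀ (η n) Q s v ω|
        ≤ S * √(2 * (A * η n) * (2 * Real.log n))) := by
    intro n
    -- The chaining bound needs L = 2 log n ≥ 3, which holds from n = 5 on; smaller n get the empty
    -- event.
    rcases lt_or_ge n 5 with hn | hn
    · exact ⟨∅, by simp, fun h => absurd h (by omega)⟩
    have hn' : (5 : ℝ) ≤ n := by exact_mod_cast hn
    have hL : 3 ≤ 2 * Real.log n := by
      have e1 : Real.log ((2 : ℝ) ^ 2) ≤ Real.log (4 : ℝ) := by norm_num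
      rw [Real.log_pow] at e1
      have e2 : Real.log ((5 : ℝ)) ≤ Real.log n := Real.log_le_log (by norm_num) hn'
      have e3 : (3 / 2 : ℝ) ≤ Real.log 5 := by
        rw [Real.le_log_iff_exp_le (by norm_num)]
        have f : Real.exp (3 / 2) ^ 2 ≤ 5 ^ 2 := by
          rw [← Real.exp_nat_mul]
          calc Real.exp ((2 : ℕ) * (3 / 2)) = Real.exp 1 ^ 3 := by
                rw [← Real.exp_nat_mul]; norm_num
            _ ≤ 2.7182818286 ^ 3 := by gcongr; exact Real.exp_one_lt_d9.le
            _ ≤ _ := by norm_num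
        exact (sq_le_sq₀ (Real.exp_nonneg _) (by norm_num)).1 f
      linarith
    obtain ⟨B, hPB, hBb⟩ := KleinGordon.exists_measure_le_chaining (P := P)
      (X := KleinGordon.coneIncrement u p₀ (η n) Q) (mul_pos hA (hη0 n)) hL
      (htail Ω P W u hW hu p₀ (η n) hp0 (hη0 n) (by
        have : p₀ ≤ √2 * a₂ := mul_le_mul_of_nonneg_left hz₀.2 h20.le
        linarith [hη4 n]))
    refine ⟨B, hPB.trans (le_of_eq ?_), fun _ ω hω hc => hBb ω hω ?_ ?_⟩
    · congr 2
      rw [Real.exp_neg, two_mul, Real.exp_add, Real.exp_log (by linarith)]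
      field_simp
    · simp [KleinGordon.coneIncrement]
    · have hη1 := (hη0 n).le
      refine ContinuousOn.sub
        (hc.comp (f := fun y : ℝ × ℝ => ((p₀ + η n * y.1 + Q * y.2) / 2,
          (p₀ + η n * y.1 - Q * y.2) / 2)) (by fun_prop) ?_)
        (hc.comp (f := fun y : ℝ × ℝ => ((p₀ + Q * y.2) / 2, (p₀ - Q * y.2) / 2))
          (by fun_prop) ?_)
      · rintro y ⟨⟨hy1, -⟩, ⟨hy2, -⟩⟩
        refine ⟨?_, mem_univ _⟩
        simp only [mem_Ici]
        positivity
      · rintro y ⟨⟨hy1, -⟩, ⟨hy2, -⟩⟩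
        refine ⟨?_, mem_univ _⟩
        simp only [mem_Ici]
        positivity
  choose B hPB hBb using hB
  have hsum : ∑' n, P (B n) ≠ ∞ := by
    refine ne_top_of_le_ne_top ?_ (ENNReal.tsum_le_tsum hPB)
    exact ((Real.summable_one_div_nat_pow.2 one_lt_two).mul_left 16).tsum_ofReal_ne_top
  filter_upwards [hcont, ae_eventually_notMem hsum] with ω hc hev w hw
  obtain ⟨n₀, hn₀⟩ := eventually_atTop.1 hev
  refine limsup_le_of_le (by isBoundedDefault) ?_
  set n₁ := max n₀ 5
  have hI : Ioo (0 : ℝ) ((1 / 2) ^ (n₁ + 1)) ∈ 𝓝[>] (0 : ℝ) := Ioo_mem_nhdsGT (by positivity)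
  filter_upwards [hI] with h hh
  have h0 := hh.1
  rw [EReal.coe_le_coe_iff]
  have hinv : (2 : ℝ) ^ (n₁ + 1) < 1 / h := by
    rw [lt_one_div (by positivity) h0, ← one_div_pow]
    exact hh.2
  -- This is the scale 2ⁿ ≤ 1/h < 2^(n+1). Then 2h ≤ η n / 2, so s = 2h / η n lies in [0, 1).
  obtain ⟨n, hn, hn'⟩ := exists_nat_pow_near
    ((one_le_pow₀ one_le_two).trans hinv.le) (one_lt_two (α := ℝ))
  have hnn : n₁ < n := by
    have := (pow_lt_pow_iff_right₀ (one_lt_two (α := ℝ))).1 (hinv.trans hn')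
    omega
  have hn5 : 5 ≤ n := by omega
  have hnB : ω ∉ B n := hn₀ n (by omega)
  have hhn : h ≤ (1 / 2) ^ n := by
    rw [one_div_pow]
    exact (le_one_div (by positivity) h0).1 hn
  have hnh : (1 / 2 : ℝ) ^ n ≤ 2 * h := by
    have := (one_div_lt h0 (by positivity)).1 hn'
    rw [← one_div_pow, pow_succ] at this
    linarith
  have hs : 2 * h / η n ∈ Ico (0 : ℝ) 1 := by
    refine ⟨by positivity, ?_⟩
    rw [div_lt_one (hη0 n)]
    simp only [hη]
    linarith
  have hv : w / (N + 1) ∈ Ico (0 : ℝ) 1 := by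
    refine ⟨div_nonneg hw.1 (by linarith), ?_⟩
    rw [div_lt_one (by linarith)]
    linarith [hw.2]
  have hb := hBb n hn5 ω hnB hc _ hs _ hv
  have es : η n * (2 * h / η n) = 2 * h := mul_div_cancel₀ _ (hη0 n).ne'
  have ev : Q * (w / (N + 1)) = √2 * w := by
    rw [hQ, mul_assoc, mul_div_cancel₀ _ (by linarith : N + 1 ≠ 0)]
  have e1 : ∀ y, √2 * y / 2 = y / √2 := fun y => by
    rw [div_eq_div_iff two_ne_zero h20.ne']
    linear_combination y * h2
  rw [KleinGordon.coneIncrement, es, ev,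
    show (p₀ + 2 * h + √2 * w) / 2 = (w + z₀) / √2 + h by rw [← e1, hp₀]; ring,
    show (p₀ + 2 * h - √2 * w) / 2 = (-w + z₀) / √2 + h by rw [← e1, hp₀]; ring,
    show (p₀ + √2 * w) / 2 = (w + z₀) / √2 by rw [← e1, hp₀]; ring,
    show (p₀ - √2 * w) / 2 = (-w + z₀) / √2 by rw [← e1, hp₀]; ring] at hb
  refine div_le_of_le_mul₀ (Real.sqrt_nonneg _) (by positivity) (hb.trans ?_)
  rw [mul_assoc S, ← Real.sqrt_mul (by positivity)]
  gcongr S * √?_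
  have hlog := KleinGordon.log_le_two_mul_log_log (by omega) hn
  have hlog0 : 0 ≤ Real.log n := Real.log_natCast_nonneg n
  calc 2 * (A * η n) * (2 * Real.log n) = 16 * A * ((1 / 2) ^ n * Real.log n) := by
        simp only [hη]; ring
    _ ≤ 16 * A * (2 * h * (2 * Real.log (Real.log (1 / h)))) := by gcongr
    _ = 64 * A * (h * Real.log (Real.log (1 / h))) := by ring
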